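/- **Model.** There are $M$ dispatchers and $N$ servers in slotted time. For each $\epsilon\in(0,\epsilon_0)$ consider the following system. The arrival vectors $(A^1(t),\dots,A^M(t))\in\mathbb{Z}_{\ge0}^M$ are i.i.d. over $t$ with an arbitrary joint law (possibly depending on $\epsilon$); $A_\Sigma=\sum_m A^m$ satisfies $\mathbb{P}(A_\Sigma=0)>0$, and $\mathbb{P}(A^m>0)>0$ for every $m$. The offered services $S_n(t)\in\mathbb{Z}_{\ge0}$ are i.i.d. over $t$, independent over $n$ and of the arrivals, with laws not depending on $\epsilon$, means $\mu_n>0$ and variances $\nu_n^2$; put $\mu_\Sigma=\sum_n\mu_n$, $\nu_\Sigma^2=\sum_n\nu_n^2$. We have $\mathbb{E}[A_\Sigma]=\mu_\Sigma-\epsilon$, and there are $\theta_1,\theta_2>0$ and $D_1,D_2<\infty$, independent of $\epsilon$, with $\mathbb{E}[e^{\theta_1A_\Sigma}]\le D_1$ and $\mathbb{E}[e^{\theta_2S_n}]\le D_2$ for all $n$. The variance of $A_\Sigma$ converges to $\sigma_\Sigma^2$ as $\epsilon\downarrow0$. **LED policy** (it may depend on $\epsilon$). Dispatcher $m$ keeps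 an estimate $\widetilde Q^m_n(t)\in\mathbb{Z}_{\ge0}$ of the queue length $Q_n(t)$ of each server $n$. In slot $t$ it sends all of its $A^m(t)$ tasks to one server, chosen with probabilities $P^m_n$ that depend only on $\widetilde{\mathbf Q}^m(t)$; given the state, the choices of the dispatchers are independent of each other and of the arrivals and services. Let $A^m_n(t)$ be the number of tasks sent from dispatcher $m$ to server $n$; then $Q_n(t+1)=\max\{Q_n(t)+\sum_mA^m_n(t)-S_n(t),0\}$. At the end of the slot some estimates are updated, by a possibly random rule that may depend on the state, the arrivals, the choices and the services of the slot. Let $\mathcal I^m_n(t)$ be the indicator that $\widetilde Q^m_n$ is updated: if it is, then $\widetilde Q^m_n(t+1)=Q_n(t+1)$; if not, then $\widetilde Q^m_n(t)\le\widetilde Q^m_n(t+1)\le\widetilde Q^m_n(t)+A^m_n(t)$. So $Z=(\mathbf Q,\widetilde{\mathbf Q}^1,\dots,\widetilde{\mathbf Q}^M)$ is a Markov chain; its state space $\mathcal Z$ is the set of states reachable from the state $0$. A steady-state distribution is a stationary distribution of the chain on $\mathcal Z$, and $\overline{\mathbf Q}^{(\epsilon)}$ denotes the queue length vector under such a distribution.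 **Tilting.** Dispatcher $m$ is $\delta$-tilted if there is a $k\in\{2,\dots,N\}$ such that in each state of $\mathcal Z$ there is a permutation $\sigma$ of the servers with $\widetilde Q^m_{\sigma(1)}\le\dots\le\widetilde Q^m_{\sigma(N)}$ for which $\Delta_i=P^m_{\sigma(i)}-\mu_{\sigma(i)}/\mu_\Sigma$ satisfies $\Delta_i\ge0$ for $i<k$, $\Delta_i\le0$ for $i\ge k$, $\Delta_1\ge\delta$ and $\Delta_N\le-\delta$. **Theorem.** Suppose that there are $\delta>0$ and $p>0$, independent of $\epsilon$, such that for all $\epsilon\in(0,\epsilon_0)$ every dispatcher is $\delta$-tilted and $\mathbb{E}[\mathcal I^m_n(t)\mid Z(t)=z]\ge p$ for all $z\in\mathcal Z$, $m$ and $n$. Then for each $\epsilon\in(0,\epsilon_0)$ a steady-state distribution exists, and for every choice of steady-state distributions the policy is heavy-traffic delay optimal: $$\limsup_{\epsilon\downarrow0}\ \epsilon\,\mathbb{E}\Big[\sum_{n=1}^N\overline Q_n^{(\epsilon)}\Big]\le\frac{\sigma_\Sigma^2+\nu_\Sigma^2}{2},$$ which matches the resource-pooled lower bound $\liminf_{\epsilon\downarrow0}\epsilon\,\mathbb{E}\big[\sum_n\overline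 Q_n^{(\epsilon)}\big]\ge(\sigma_\Sigma^2+\nu_\Sigma^2)/2$, which holds as well. -/

import Mathlib

open Filter Topology MeasureTheory ProbabilityTheory
open scoped ENNReal

noncomputable section

namespace LED

/-! ### Laws of integer-valued primitives -/

/-- Mean of an `ℕ`-valued random variable with law `q`. -/
def mean (q : PMF ℕ) : ℝ := ∫ x, (x : ℝ) ∂q.toMeasure

/-- Variance of an `ℕ`-valued random variable with law `q`. -/
def var (q : PMF ℕ) : ℝ := variance (fun x : ℕ => (x : ℝ)) q.toMeasure

/-- The exponential moment bound `E[exp (θ X)] ≤ D`, as an inequality in `[0, ∞]`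
(so that it entails finiteness of the moment). -/
def ExpMomentLE (q : PMF ℕ) (θ D : ℝ) : Prop :=
  ∫⁻ x, ENNReal.ofReal (Real.exp (θ * (x : ℝ))) ∂q.toMeasure ≤ ENNReal.ofReal D

/-- Joint law of finitely many independent discrete random variables with laws `q i`. -/
def indep {ι α : Type} [Fintype ι] [Countable α] (q : ι → PMF α) : PMF (ι → α) :=
  letI : MeasurableSpace α := ⊤
  haveI : MeasurableSingletonClass α := ⟨fun _ => trivial⟩
  (Measure.pi fun i => (q i).toMeasure).toPMF

/-! ### State, arrivals and queue dynamics

`M` dispatchers, `N` servers. -/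

/-- System state `Z = (Q, (Q̃¹, …, Q̃ᴹ))`: the queue lengths together with the local estimates,
`est m n` being dispatcher `m`'s estimate of the queue length of server `n`. -/
@[ext]
structure State (M N : ℕ) where
  queue : Fin N → ℕ
  est : Fin M → Fin N → ℕ

/-- The empty system, in which all the local estimates are zero. -/
def State.init (M N : ℕ) : State M N := ⟨fun _ => 0, fun _ _ => 0⟩

/-- Law of the total number of arrivals `A_Σ = ∑ₘ Aᵐ`, when `A` is the joint law of the
numbers of arrivals at the dispatchers. -/
def totalArrival {M : ℕ} (A : PMF (Fin M → ℕ)) : PMF ℕ := A.map fun a => ∑ m, a m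

/-- `Aᵐₙ`: arrivals from dispatcher `m` to server `n`, when `a m` tasks arrive at dispatcher `m`,
all of which are sent to server `r m`. -/
def arrivalFrom {M N : ℕ} (a : Fin M → ℕ) (r : Fin M → Fin N) (m : Fin M) (n : Fin N) : ℕ :=
  if r m = n then a m else 0

/-- `Aₙ = ∑ₘ Aᵐₙ`. -/
def arrivalTo {M N : ℕ} (a : Fin M → ℕ) (r : Fin M → Fin N) (n : Fin N) : ℕ :=
  ∑ m, arrivalFrom a r m n

/-- `Qₙ(t+1) = Qₙ(t) + Aₙ(t) - Sₙ(t) + Uₙ(t)` with `Uₙ = max (Sₙ - Qₙ - Aₙ) 0`, that is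
`Qₙ(t+1) = max (Qₙ(t) + Aₙ(t) - Sₙ(t)) 0`: the subtraction of natural numbers is truncated. -/
def nextQueue {M N : ℕ} (z : State M N) (a : Fin M → ℕ) (r : Fin M → Fin N) (s : Fin N → ℕ)
    (n : Fin N) : ℕ :=
  z.queue n + arrivalTo a r n - s n

/-! ### Local-estimation-driven policies -/

/-- A local-estimation-driven policy.

* `dispatch m q` is the law of the server to which dispatcher `m` sends its new arrivals when
  its vector of local estimates is `q`.
* `update z a r s` is the joint law of the update indicators `Iᵐₙ` and of the new local estimates
  at the end of a slot which began in state `z`, with arrivals `a`, chosen servers `r` and offered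
  services `s`. An estimate that gets updated becomes the true queue length at the end of
  the slot. One that does not get updated never decreases, and a dispatcher may (or may not) count
  in the tasks which it has itself sent to the server during the slot. -/
structure Policy (M N : ℕ) where
  dispatch : Fin M → (Fin N → ℕ) → PMF (Fin N)
  update : State M N → (Fin M → ℕ) → (Fin M → Fin N) → (Fin N → ℕ) →
    PMF ((Fin M → Fin N → Bool) × (Fin M → Fin N → ℕ))
  est_of_updated : ∀ z a r s, ∀ w ∈ (update z a r s).support, ∀ m n,
    w.1 m n = true → w.2 m n = nextQueue z a r s n
  est_of_not_updated : ∀ z a r s, ∀ w ∈ (update z a r s).support, ∀ m n,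
    w.1 m n = false → z.est m n ≤ w.2 m n ∧ w.2 m n ≤ z.est m n + arrivalFrom a r m n

section Chain

variable {M N : ℕ} (A : PMF (Fin M → ℕ)) (S : Fin N → PMF ℕ) (P : Policy M N)

/-- Joint law of the update indicators and the next state, given the present state `z`: the
arrivals, the choices of the dispatchers and the offered services are independent given `z`. -/
def slot (z : State M N) : PMF ((Fin M → Fin N → Bool) × State M N) :=
  A.bind fun a =>
  (indep fun m => P.dispatch m (z.est m)).bind fun r =>
  (indep S).bind fun s =>
  (P.update z a r s).map fun w => (w.1, ⟨nextQueue z a r s, w.2⟩)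

/-- One-step transition law of the Markov chain `Z(t)`. -/
def step (z : State M N) : PMF (State M N) := (slot A S P z).map Prod.snd

/-- `E[Iᵐₙ(t) | Z(t) = z]`. -/
def updateProb (z : State M N) (m : Fin M) (n : Fin N) : ℝ≥0∞ :=
  ((slot A S P z).map fun w => w.1 m n) true

/-- The state space of the chain: all the states that can be reached from the empty system. -/
def stateSpace : Set (State M N) :=
  {z | Relation.ReflTransGen (fun x y => y ∈ (step A S P x).support) (State.init M N) z}

/-- `π` is a steady-state (stationary) distribution of the chain on its state space. -/
def IsSteadyState (π : PMF (State M N)) : Prop :=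
  π.support ⊆ stateSpace A S P ∧ π.bind (step A S P) = π

/-- `Δᵐ` for the local estimates `q` and the ordering `σ` of the servers: the `i`-th entry is the
probability of choosing server `σ i`, minus `μ_{σ i} / μ_Σ`. -/
def preference (m : Fin M) (q : Fin N → ℕ) (σ : Equiv.Perm (Fin N)) (i : Fin N) : ℝ :=
  (P.dispatch m q (σ i)).toReal - mean (S (σ i)) / ∑ n, mean (S n)

/-- The dispatching strategy of dispatcher `m` is `δ`-tilted: for some `k ∈ {2, …, N}`, in every
state, the servers can be put in increasing order of their local estimates so that the preference
is `≥ 0` at the positions before `k`, `≤ 0` from position `k` on, `≥ δ` at the first position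
and `≤ -δ` at the last one. Position `i : Fin N` is the `(i + 1)`-st. -/
def IsDeltaTilted (δ : ℝ) (m : Fin M) : Prop :=
  ∃ k : ℕ, 2 ≤ k ∧ k ≤ N ∧ ∀ z ∈ stateSpace A S P, ∃ σ : Equiv.Perm (Fin N),
    Monotone (fun i => z.est m (σ i)) ∧
    ∀ i : Fin N,
      ((i : ℕ) + 1 < k → 0 ≤ preference S P m (z.est m) σ i) ∧
      (k ≤ (i : ℕ) + 1 → preference S P m (z.est m) σ i ≤ 0) ∧
      ((i : ℕ) + 1 = 1 → δ ≤ preference S P m (z.est m) σ i) ∧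
      ((i : ℕ) + 1 = N → preference S P m (z.est m) σ i ≤ -δ)

end Chain

/-- `E[∑ₙ Q̄ₙ]` (in `[0, ∞]`) for the state distribution `π`. -/
def meanTotalQueue {M N : ℕ} (π : PMF (State M N)) : ℝ≥0∞ :=
  ∑' z, π z * ((∑ n, z.queue n : ℕ) : ℝ≥0∞)

/-- `limsup_{ε ↓ 0} ε E[∑ₙ Q̄ₙ^(ε)] ≤ ζ / 2` for the steady-state distributions `π ε`. -/
def HeavyTrafficDelayOptimal {M N : ℕ} (π : ℝ → PMF (State M N)) (ζ : ℝ) : Prop :=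
  limsup (fun ε => ENNReal.ofReal ε * meanTotalQueue (π ε)) (𝓝[>] 0) ≤ ENNReal.ofReal (ζ / 2)

/-- `liminf_{ε ↓ 0} ε E[∑ₙ Q̄ₙ^(ε)] ≥ ζ / 2`: the resource-pooled lower bound. -/
def ResourcePooledLowerBound {M N : ℕ} (π : ℝ → PMF (State M N)) (ζ : ℝ) : Prop :=
  ENNReal.ofReal (ζ / 2) ≤ liminf (fun ε => ENNReal.ofReal ε * meanTotalQueue (π ε)) (𝓝[>] 0)

end LED

end

noncomputable section

namespace LED

/-! ### Foster–Lyapunov criteria for countable Markov chains -/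

section Foster

variable {X : Type*} (K : X → PMF X)

/-! The method is Lyapunov drift with state-space collapse. Let `T` be the total queue length, `X`
the arrivals minus the offered services of a slot and `U` the total unused service, so that the next
total is `T' = T + X + U`. As `X` is independent of the state and has mean `-ε`, equating the
steady-state means of `T'²` and `T²` gives `ε E[T] = E[X²]/2 + E[T'U] - E[U²]/2`
(`mul_integral_total_eq`), where `E[X²]` is the sum of the variances plus `ε²`. It remains to show
that the last two terms vanish as `ε ↓ 0`.

Equating the means of `T'` and `T` gives `E[U] = ε`; since `U` is dominated by a load with bounded
moments, `E[U²] → 0` (`unusedSq_le`). This already yields the lower bound, because `E[T'U] ≥ 0`. For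
the upper bound, service is wasted only at queues that end the slot empty, so `T'U ≤ N R' U`, where
`R` is the norm of the deviation of the queue vector from its mean and `R'` its next value
(`Outcome.total_next_mul_totalUnused_le`). Hence it suffices to bound `E[R²]` uniformly in `ε`,
which is the state-space collapse (`exists_collapse_bound`).

Tilting decreases the range of the estimated queue lengths at rate `δ` (`sum_mul_le_of_tilted`);
passing to the true queues costs a multiple of the estimation errors `e` (`sum_q_mul_bias_le`). An
estimate is corrected with probability at least `p` and otherwise its error grows by at most the
load, so the errors contract on their own. The Lyapunov function `R⁴ + K ∑ e³` combines the two: the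
cross term `R² e` in the drift of `R⁴` is split by Young's inequality into a small multiple of `R³`
and a multiple of `e³`, which is absorbed when `K` is large (`exists_lyapunov_constants`). The
result is a bound on `E[R³]` with constants free of `ε`.

The same function with the full norm of the queue vector in place of `R` has a negative drift of
order `ε`, due to the spare capacity (`exists_drift_zero`). This bound degenerates as `ε ↓ 0`, but
it is only used for existence of a steady state (`exists_stationary_of_drift`) and for integrability
of `T²`. The parameter `κ ∈ {0, 1}` treats both norms at once. Moment bounds are deduced for every
stationary law without integrability assumed in advance (`tsum_stationary_le_of_drift`). -/

theorem tsum_bind_mul {α β : Type*} (p : PMF α) (k : α → PMF β) (f : β → ℝ≥0∞) :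
    ∑' y, p.bind k y * f y = ∑' x, p x * ∑' y, k x y * f y := by
  simp_rw [PMF.bind_apply, ← ENNReal.tsum_mul_right, ← ENNReal.tsum_mul_left]
  rw [ENNReal.tsum_comm]
  simp_rw [mul_assoc]

theorem tsum_pmf_mul_le_of_forall_le {α : Type*} (p : PMF α) {f : α → ℝ≥0∞} {c : ℝ≥0∞}
    (h : ∀ x ∈ p.support, f x ≤ c) : ∑' x, p x * f x ≤ c := by
  calc ∑' x, p x * f x ≤ ∑' x, p x * c := by
        refine ENNReal.tsum_le_tsum fun x => ?_
        by_cases hx : x ∈ p.support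
        · gcongr
          exact h x hx
        · simp [(p.apply_eq_zero_iff x).2 hx]
    _ = c := by rw [ENNReal.tsum_mul_right, p.tsum_coe, one_mul]

/-- Moment bound from a drift condition: no integrability of the Lyapunov function is needed. -/
theorem tsum_stationary_le_of_drift {s : Set X} {V f : X → ℝ≥0∞} {b : ℝ≥0∞}
    (hV : ∀ x ∈ s, V x ≠ ∞)
    (hdrift : ∀ x ∈ s, ∑' y, K x y * V y + f x ≤ V x + b)
    {π : PMF X} (hs : π.support ⊆ s) (hπ : π.bind K = π) :
    ∑' x, π x * f x ≤ b := by
  classical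
  -- Truncating `V` at `c` makes its stationary mean finite, so it can be cancelled. The drift
  -- inequality survives where `V < c`; elsewhere the truncated function is at its maximum `c` and
  -- cannot increase.
  have key : ∀ c : ℝ≥0∞, c ≠ ∞ → ∑' x, π x * (if V x < c then f x else 0) ≤ b := by
    intro c hc
    have h1 : ∑' x, π x * min (V x) c = ∑' x, π x * ∑' y, K x y * min (V y) c := by
      rw [← tsum_bind_mul, hπ]
    have hfin : ∑' x, π x * min (V x) c ≠ ∞ :=
      ((tsum_pmf_mul_le_of_forall_le π fun x _ => min_le_right _ _).trans_lt hc.lt_top).ne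
    have h2 : ∑' x, π x * min (V x) c + ∑' x, π x * (if V x < c then f x else 0)
        ≤ ∑' x, π x * min (V x) c + b := by
      conv_lhs => rw [h1]
      rw [← ENNReal.tsum_add]
      have hb : b = ∑' x, π x * b := by rw [ENNReal.tsum_mul_right, π.tsum_coe, one_mul]
      conv_rhs => rw [hb]
      rw [← ENNReal.tsum_add]
      refine ENNReal.tsum_le_tsum fun x => ?_
      rw [← mul_add, ← mul_add]
      by_cases hx : x ∈ π.support
      · refine mul_le_mul_right ?_ _
        split_ifs with hlt
        · rw [min_eq_left hlt.le]
          refine le_trans ?_ (hdrift x (hs hx))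
          gcongr
          exact min_le_left _ _
        · rw [add_zero, min_eq_right (not_lt.1 hlt)]
          exact (tsum_pmf_mul_le_of_forall_le _ fun y _ => min_le_right _ _).trans le_self_add
      · simp [(π.apply_eq_zero_iff x).2 hx]
    exact (ENNReal.add_le_add_iff_left hfin).1 h2
  rw [ENNReal.tsum_eq_iSup_sum]
  refine iSup_le fun F => ?_
  -- A finite truncation level above `V` on all of `F ∩ s`.
  set c : ℝ≥0∞ := ∑ x ∈ F.filter (· ∈ s), V x + 1 with hc
  have hsum : ∑ x ∈ F.filter (· ∈ s), V x ≠ ∞ :=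
    (ENNReal.sum_lt_top.2 fun x hx => (hV x (Finset.mem_filter.1 hx).2).lt_top).ne
  refine le_trans ?_ (key c (by finiteness))
  refine le_trans (Finset.sum_le_sum fun x hx => ?_) (ENNReal.sum_le_tsum F)
  by_cases hx' : x ∈ π.support
  · have : V x < c := by
      refine lt_of_le_of_lt (Finset.single_le_sum (f := V) (fun _ _ => zero_le)
        (Finset.mem_filter.2 ⟨hx, hs hx'⟩)) ?_
      exact ENNReal.lt_add_right hsum one_ne_zero
    rw [if_pos this]
  · simp [(π.apply_eq_zero_iff x).2 hx']

/-- Law of the chain with kernel `K` at time `t`, started at `x`. -/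
def chainLaw (x : X) : ℕ → PMF X
  | 0 => PMF.pure x
  | t + 1 => (chainLaw x t).bind K

/-- Cesàro averages of the laws of the chain. -/
def cesaro (x : X) (t : ℕ) (y : X) : ℝ≥0∞ :=
  (∑ i ∈ Finset.range (t + 1), chainLaw K x i y) / (t + 1 : ℕ)

theorem support_chainLaw_subset {s : Set X} {x : X} (hx : x ∈ s)
    (hs : ∀ x ∈ s, (K x).support ⊆ s) (t : ℕ) : (chainLaw K x t).support ⊆ s := by
  induction t with
  | zero => simp [chainLaw, hx]
  | succ t ih =>
    intro y hy
    rw [chainLaw, PMF.mem_support_bind_iff] at hy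
    obtain ⟨z, hz, hy⟩ := hy
    exact hs z (ih hz) hy

theorem cesaro_eq_zero {s : Set X} {x : X} (hx : x ∈ s)
    (hs : ∀ x ∈ s, (K x).support ⊆ s) (t : ℕ) {y : X} (hy : y ∉ s) : cesaro K x t y = 0 := by
  have : ∀ i, chainLaw K x i y = 0 := fun i =>
    (PMF.apply_eq_zero_iff _ _).2 fun h => hy (support_chainLaw_subset K hx hs i h)
  simp [cesaro, this]

theorem tsum_cesaro_mul (x : X) (t : ℕ) (f : X → ℝ≥0∞) :
    ∑' y, cesaro K x t y * f y
      = (∑ i ∈ Finset.range (t + 1), ∑' y, chainLaw K x i y * f y) / (t + 1 : ℕ) := by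
  simp_rw [cesaro, div_eq_mul_inv, mul_right_comm _ _ (f _), ENNReal.tsum_mul_right]
  congr 1
  simp_rw [Finset.sum_mul]
  rw [Summable.tsum_finsetSum fun _ _ => ENNReal.summable]

theorem tsum_cesaro (x : X) (t : ℕ) : ∑' y, cesaro K x t y = 1 := by
  have := tsum_cesaro_mul K x t 1
  simp only [Pi.one_apply, mul_one, PMF.tsum_coe, Finset.sum_const, Finset.card_range,
    nsmul_eq_mul] at this
  rw [this]
  exact ENNReal.div_self (by simp) (by simp)

/-- The drift inequality telescopes along the chain: the first `t + 1` means of `f` add up to at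
most `V x + (t + 1) b`. Dividing by `t + 1` gives a bound uniform in `t`, hence tightness when the
sublevel sets of `f` are finite. -/
theorem tsum_cesaro_mul_le_of_drift {s : Set X} {V f : X → ℝ≥0∞} {b : ℝ≥0∞} {x : X} (hx : x ∈ s)
    (hs : ∀ x ∈ s, (K x).support ⊆ s)
    (hdrift : ∀ x ∈ s, ∑' y, K x y * V y + f x ≤ V x + b) (t : ℕ) :
    ∑' y, cesaro K x t y * f y ≤ V x + b := by
  have hstep : ∀ i, ∑' y, chainLaw K x (i + 1) y * V y + ∑' y, chainLaw K x i y * f y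
      ≤ ∑' y, chainLaw K x i y * V y + b := by
    intro i
    rw [chainLaw, tsum_bind_mul, ← ENNReal.tsum_add]
    have hb : b = ∑' y, chainLaw K x i y * b := by
      rw [ENNReal.tsum_mul_right, PMF.tsum_coe, one_mul]
    conv_rhs => rw [hb]
    rw [← ENNReal.tsum_add]
    refine ENNReal.tsum_le_tsum fun y => ?_
    rw [← mul_add, ← mul_add]
    by_cases hy : y ∈ (chainLaw K x i).support
    · refine mul_le_mul_right ?_ _
      exact hdrift y (support_chainLaw_subset K hx hs i hy)
    · simp [((chainLaw K x i).apply_eq_zero_iff y).2 hy]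
  have hsum : ∀ t, ∑' y, chainLaw K x t y * V y
      + ∑ i ∈ Finset.range t, ∑' y, chainLaw K x i y * f y ≤ V x + t * b := by
    intro t
    induction t with
    | zero =>
      simp only [chainLaw, Finset.range_zero, Finset.sum_empty, add_zero, Nat.cast_zero, zero_mul]
      exact tsum_pmf_mul_le_of_forall_le _ (by simp)
    | succ t ih =>
      rw [Finset.sum_range_succ]
      calc _ = (∑' y, chainLaw K x (t + 1) y * V y + ∑' y, chainLaw K x t y * f y)
            + ∑ i ∈ Finset.range t, ∑' y, chainLaw K x i y * f y := by abel
        _ ≤ (∑' y, chainLaw K x t y * V y + b)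
            + ∑ i ∈ Finset.range t, ∑' y, chainLaw K x i y * f y := add_le_add_left (hstep t) _
        _ = (∑' y, chainLaw K x t y * V y
            + ∑ i ∈ Finset.range t, ∑' y, chainLaw K x i y * f y) + b := by abel
        _ ≤ V x + t * b + b := by gcongr
        _ = _ := by push_cast; ring
  rw [tsum_cesaro_mul]
  refine ENNReal.div_le_of_le_mul ?_
  refine le_trans (le_add_self.trans (hsum (t + 1))) ?_
  rw [add_mul, mul_comm b]
  gcongr
  exact le_mul_of_one_le_right zero_le (by simp)

/-- Cesàro averages are asymptotically invariant. -/
theorem cesaro_bind_le (x : X) (t : ℕ) (y : X) :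
    ∑' z, cesaro K x t z * K z y ≤ cesaro K x t y + 1 / (t + 1 : ℕ) := by
  rw [tsum_cesaro_mul, cesaro, ← ENNReal.add_div]
  gcongr
  have : ∀ i, ∑' z, chainLaw K x i z * K z y = chainLaw K x (i + 1) y := fun i => by
    rw [chainLaw, PMF.bind_apply]
  simp_rw [this]
  rw [Finset.sum_range_succ, Finset.sum_range_succ']
  refine add_le_add le_self_add (PMF.coe_le_one _ _)

theorem tendsto_const_div_natCast {B : ℝ≥0∞} (hB : B ≠ ∞) :
    Tendsto (fun c : ℕ => B / (c : ℝ≥0∞)) atTop (𝓝 0) := by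
  simp_rw [div_eq_mul_inv]
  simpa using ENNReal.Tendsto.const_mul ENNReal.tendsto_inv_nat_nhds_zero (Or.inr hB)

/-- Markov's inequality: outside `F` the mass at a point is at most `g y * f y / c`. -/
theorem sum_mul_add_const_ge {g : X → ℝ≥0∞} (hg : ∑' y, g y = 1) {f : X → ℝ≥0∞} {B c : ℝ≥0∞}
    (hc : c ≠ 0) (hc' : c ≠ ∞)
    (hf : ∑' y, g y * f y ≤ B) {F : Finset X} (hF : ∀ y, g y ≠ 0 → f y ≤ c → y ∈ F) :
    1 ≤ ∑ y ∈ F, g y + B / c := by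
  classical
  calc 1 = ∑' y, g y := hg.symm
    _ ≤ ∑' y, ((if y ∈ F then g y else 0) + g y * f y / c) := by
        refine ENNReal.tsum_le_tsum fun y => ?_
        split_ifs with hy
        · exact le_self_add
        · rw [zero_add]
          by_cases h0 : g y = 0
          · simp [h0]
          · have hlt : c ≤ f y := (not_le.1 fun h => hy (hF y h0 h)).le
            rw [ENNReal.le_div_iff_mul_le (Or.inl hc) (Or.inl hc')]
            gcongr
    _ = ∑ y ∈ F, g y + (∑' y, g y * f y) / c := by
        rw [ENNReal.tsum_add]
        simp_rw [div_eq_mul_inv]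
        rw [ENNReal.tsum_mul_right]
        congr 1
        rw [tsum_eq_sum (s := F) (fun y hy => if_neg hy)]
        exact Finset.sum_congr rfl fun y hy => if_pos hy
    _ ≤ _ := by gcongr

/-- Existence of a stationary distribution from a drift condition. -/
theorem exists_stationary_of_drift {s : Set X} {V f : X → ℝ≥0∞} {b : ℝ≥0∞} {x : X} (hx : x ∈ s)
    (hs : ∀ x ∈ s, (K x).support ⊆ s) (hV : V x ≠ ∞) (hb : b ≠ ∞)
    (hdrift : ∀ x ∈ s, ∑' y, K x y * V y + f x ≤ V x + b)
    (hf : ∀ c : ℕ, {y ∈ s | f y ≤ c}.Finite) :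
    ∃ π : PMF X, π.support ⊆ s ∧ π.bind K = π := by
  classical
  set B := V x + b with hB
  have hBtop : B ≠ ∞ := by finiteness
  -- Limits along a free ultrafilter exist at all points simultaneously by compactness of `[0, ∞]`,
  -- so no subsequence has to be extracted.
  let U : Ultrafilter ℕ := hyperfilter ℕ
  have hUtop : (U : Filter ℕ) ≤ atTop := by
    rw [← Nat.cofinite_eq_atTop]; exact hyperfilter_le_cofinite
  have hlim : ∀ y, ∃ l, Tendsto (fun t => cesaro K x t y) U (𝓝 l) := fun y => by
    obtain ⟨l, -, hl⟩ := (isCompact_univ (X := ℝ≥0∞)).ultrafilter_le_nhds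
      (U.map fun t => cesaro K x t y) (by simp)
    exact ⟨l, hl⟩
  choose g hg using hlim
  have hsumle : ∑' y, g y ≤ 1 := by
    rw [ENNReal.tsum_eq_iSup_sum]
    refine iSup_le fun F => le_of_tendsto (tendsto_finsetSum F fun y _ => hg y)
      (Eventually.of_forall fun t => ?_)
    exact (ENNReal.sum_le_tsum F).trans (tsum_cesaro K x t).le
  -- Tightness: up to `B / c`, the mass of all the averages lies in one finite sublevel set, so none
  -- escapes in the limit.
  have hsumge : ∀ c : ℕ, c ≠ 0 → 1 ≤ ∑' y, g y + B / c := by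
    intro c hc
    have h : 1 ≤ ∑ y ∈ (hf c).toFinset, g y + B / c := by
      refine ge_of_tendsto ((tendsto_finsetSum _ fun y _ => hg y).add_const (B / (c : ℝ≥0∞)))
        (Eventually.of_forall fun t => ?_)
      refine sum_mul_add_const_ge (tsum_cesaro K x t) (by simpa using hc) (by simp)
        (tsum_cesaro_mul_le_of_drift K hx hs hdrift t) fun y hy hfy => ?_
      rw [Set.Finite.mem_toFinset]
      exact ⟨by_contra fun h => hy (cesaro_eq_zero K hx hs t h), hfy⟩
    refine h.trans ?_
    gcongr
    exact ENNReal.sum_le_tsum _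
  have hsum : ∑' y, g y = 1 := by
    refine le_antisymm hsumle ?_
    have hz : Tendsto (fun c : ℕ => ∑' y, g y + B / (c : ℝ≥0∞)) atTop (𝓝 (∑' y, g y + 0)) := by
      refine tendsto_const_nhds.add ?_
      exact tendsto_const_div_natCast hBtop
    rw [add_zero] at hz
    exact ge_of_tendsto hz ((eventually_ne_atTop 0).mono fun c hc => hsumge c hc)
  let π : PMF X := ⟨g, hsum ▸ ENNReal.summable.hasSum⟩
  have hπ : ∀ y, π y = g y := fun _ => rfl
  -- Passing to the limit in finite partial sums gives only this inequality, as in Fatou's lemma.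
  -- Equality follows below because both sides have total mass one.
  have hle : ∀ y, π.bind K y ≤ π y := by
    intro y
    rw [PMF.bind_apply, ENNReal.tsum_eq_iSup_sum]
    refine iSup_le fun F => ?_
    have hinv : Tendsto (fun t : ℕ => cesaro K x t y + 1 / ((t + 1 : ℕ) : ℝ≥0∞)) U
        (𝓝 (g y + 0)) := by
      refine (hg y).add (Tendsto.mono_left ?_ hUtop)
      exact (tendsto_const_div_natCast ENNReal.one_ne_top).comp
        (tendsto_add_atTop_nat 1)
    rw [add_zero] at hinv
    refine le_of_tendsto_of_tendsto (tendsto_finsetSum F fun z _ =>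
      ENNReal.Tendsto.mul_const (hg z) (Or.inr (PMF.apply_ne_top _ _))) hinv
      (Eventually.of_forall fun t => ?_)
    exact (ENNReal.sum_le_tsum F).trans (cesaro_bind_le K x t y)
  refine ⟨π, fun y hy => by_contra fun hys => ?_, ?_⟩
  · rw [PMF.mem_support_iff, hπ] at hy
    refine hy (tendsto_nhds_unique (hg y) ?_)
    simp_rw [cesaro_eq_zero K hx hs _ hys]
    exact tendsto_const_nhds
  · refine PMF.ext fun y => le_antisymm (hle y) ?_
    by_contra! hlt
    have h1 : ∑' z, π.bind K z < ∑' z, π z :=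
      ENNReal.tsum_lt_tsum (by rw [PMF.tsum_coe]; simp) hle hlt
    rw [PMF.tsum_coe, PMF.tsum_coe] at h1
    exact lt_irrefl _ h1

end Foster

/-! ### Expectations under discrete laws -/

section Discrete

variable {α β : Type*} [MeasurableSpace α] [MeasurableSpace β] [Countable α] [Countable β]
  [MeasurableSingletonClass α] [MeasurableSingletonClass β]

theorem lintegral_toMeasure_eq_tsum (p : PMF α) (f : α → ℝ≥0∞) :
    ∫⁻ x, f x ∂p.toMeasure = ∑' x, p x * f x := by
  rw [lintegral_countable']
  refine tsum_congr fun x => ?_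
  rw [PMF.toMeasure_apply_singleton _ _ (measurableSet_singleton x), mul_comm]

theorem ae_mem_support (p : PMF α) : ∀ᵐ x ∂p.toMeasure, x ∈ p.support := by
  rw [ae_iff, PMF.toMeasure_apply_eq_zero_iff _ (Set.to_countable _).measurableSet]
  exact Set.disjoint_left.2 fun x hx hx' => hx' hx

theorem integral_toMeasure_map (p : PMF α) (g : α → β) (f : β → ℝ) :
    ∫ y, f y ∂(p.map g).toMeasure = ∫ x, f (g x) ∂p.toMeasure := by
  rw [← PMF.toMeasure_map g p (measurable_of_countable g),
    integral_map (measurable_of_countable g).aemeasurable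
      (measurable_of_countable f).aestronglyMeasurable]

theorem lintegral_toMeasure_map (p : PMF α) (g : α → β) (f : β → ℝ≥0∞) :
    ∫⁻ y, f y ∂(p.map g).toMeasure = ∫⁻ x, f (g x) ∂p.toMeasure := by
  rw [← PMF.toMeasure_map g p (measurable_of_countable g),
    lintegral_map (measurable_of_countable f) (measurable_of_countable g)]

theorem integrable_toMeasure_map_iff (p : PMF α) (g : α → β) (f : β → ℝ) :
    Integrable f (p.map g).toMeasure ↔ Integrable (fun x => f (g x)) p.toMeasure := by
  rw [← PMF.toMeasure_map g p (measurable_of_countable g),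
    integrable_map_measure (measurable_of_countable f).aestronglyMeasurable
      (measurable_of_countable g).aemeasurable]
  rfl

theorem toMeasure_bind_map_prodMk (p : PMF α) (q : PMF β) :
    (p.bind fun x => q.map (Prod.mk x)).toMeasure = p.toMeasure.prod q.toMeasure := by
  classical
  refine Measure.ext_of_singleton fun ⟨a, b⟩ => ?_
  rw [PMF.toMeasure_apply_singleton _ _ (measurableSet_singleton _), ← Set.singleton_prod_singleton,
    Measure.prod_prod, PMF.toMeasure_apply_singleton _ _ (measurableSet_singleton _),
    PMF.toMeasure_apply_singleton _ _ (measurableSet_singleton _), PMF.bind_apply,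
    tsum_eq_single a]
  · congr 1
    rw [PMF.map_apply, tsum_eq_single b]
    · simp
    · intro b' hb'
      simp [Ne.symm hb']
  · intro a' ha'
    simp [PMF.map_apply, Ne.symm ha']

/-- A nonnegative function whose expectation in `[0, ∞]` is finite is integrable. -/
theorem integrable_of_lintegral_le {μ : Measure α} {f : α → ℝ} (hf : ∀ x, 0 ≤ f x) {C : ℝ}
    (h : ∫⁻ x, ENNReal.ofReal (f x) ∂μ ≤ ENNReal.ofReal C) : Integrable f μ := by
  refine ⟨(measurable_of_countable f).aestronglyMeasurable, ?_⟩
  rw [hasFiniteIntegral_iff_ofReal (Eventually.of_forall hf)]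
  exact h.trans_lt ENNReal.ofReal_lt_top

theorem integral_le_of_lintegral_le {μ : Measure α} {f : α → ℝ} (hf : ∀ x, 0 ≤ f x) {C : ℝ}
    (hC : 0 ≤ C)
    (h : ∫⁻ x, ENNReal.ofReal (f x) ∂μ ≤ ENNReal.ofReal C) : ∫ x, f x ∂μ ≤ C := by
  rw [integral_eq_lintegral_of_nonneg_ae (Eventually.of_forall hf)
    (measurable_of_countable f).aestronglyMeasurable]
  exact ENNReal.toReal_le_of_le_ofReal hC h

theorem integrable_of_abs_le {μ : Measure α} {f g : α → ℝ} (hg : Integrable g μ)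
    (h : ∀ᵐ x ∂μ, |f x| ≤ g x) : Integrable f μ :=
  hg.mono' (measurable_of_countable f).aestronglyMeasurable h

end Discrete

theorem toMeasure_indep_nat {ι : Type} [Fintype ι] (q : ι → PMF ℕ) :
    (indep q).toMeasure = Measure.pi fun i => (q i).toMeasure := by
  unfold indep
  exact Measure.toPMF_toMeasure _

theorem toMeasure_indep_fin {ι : Type} [Fintype ι] {N : ℕ} (q : ι → PMF (Fin N)) :
    (indep q).toMeasure = Measure.pi fun i => (q i).toMeasure := by
  unfold indep
  exact Measure.toPMF_toMeasure _

/-- Fourth moments are controlled by exponential moments. -/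
theorem ExpMomentLE.lintegral_pow_four_le {q : PMF ℕ} {θ D : ℝ} (hθ : 0 < θ)
    (h : ExpMomentLE q θ D) :
    ∫⁻ x, ENNReal.ofReal ((x : ℝ) ^ 4) ∂q.toMeasure ≤ ENNReal.ofReal (24 / θ ^ 4 * D) := by
  have hle : ∀ x : ℕ, (x : ℝ) ^ 4 ≤ 24 / θ ^ 4 * Real.exp (θ * x) := fun x => by
    have := Real.pow_div_factorial_le_exp (θ * x) (by positivity) 4
    rw [div_mul_eq_mul_div, le_div_iff₀ (by positivity)]
    norm_num [Nat.factorial] at this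
    rw [mul_pow] at this
    linarith
  calc _ ≤ ∫⁻ x, ENNReal.ofReal (24 / θ ^ 4) * ENNReal.ofReal (Real.exp (θ * (x : ℝ)))
        ∂q.toMeasure := by
        refine lintegral_mono fun x => ?_
        rw [← ENNReal.ofReal_mul (by positivity)]
        exact ENNReal.ofReal_le_ofReal (hle x)
    _ = ENNReal.ofReal (24 / θ ^ 4) * ∫⁻ x, ENNReal.ofReal (Real.exp (θ * (x : ℝ)))
        ∂q.toMeasure := lintegral_const_mul _ (measurable_of_countable _)
    _ ≤ ENNReal.ofReal (24 / θ ^ 4) * ENNReal.ofReal D := by gcongr; exact h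
    _ = _ := by rw [← ENNReal.ofReal_mul (by positivity)]

/-! ### Outcomes of a slot -/

instance {M N : ℕ} : MeasurableSpace (State M N) := ⊤

instance {M N : ℕ} : DiscreteMeasurableSpace (State M N) := ⟨fun _ => trivial⟩

instance {M N : ℕ} : Countable (State M N) :=
  Function.Injective.countable (f := fun z : State M N => (z.queue, z.est)) fun x y h => by
    simp only [Prod.mk.injEq] at h
    exact State.ext h.1 h.2

/-- Everything that is random in a slot: arrivals, chosen servers, offered services, and the update
indicators together with the new estimates. -/
abbrev Outcome (M N : ℕ) : Type :=
  (Fin M → ℕ) × (Fin M → Fin N) × (Fin N → ℕ) × ((Fin M → Fin N → Bool) × (Fin M → Fin N → ℕ))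

/-- The state at the end of the slot. -/
def Outcome.next {M N : ℕ} (z : State M N) (x : Outcome M N) : State M N :=
  ⟨nextQueue z x.1 x.2.1 x.2.2.1, x.2.2.2.2⟩

/-- One plus the total number of arrivals and offered services of the slot. -/
def Outcome.load {M N : ℕ} (x : Outcome M N) : ℝ :=
  1 + (∑ m, (x.1 m : ℝ) + ∑ n, (x.2.2.1 n : ℝ))

section Chain

variable {M N : ℕ} (A : PMF (Fin M → ℕ)) (S : Fin N → PMF ℕ) (P : Policy M N)

/-- Law of the outcome of a slot that begins in state `z`. -/
def outcome (z : State M N) : PMF (Outcome M N) :=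
  A.bind fun a =>
  (indep fun m => P.dispatch m (z.est m)).bind fun r =>
  (indep S).bind fun s =>
  (P.update z a r s).map fun w => (a, r, s, w)

/-- `outcome` keeps all the randomness of a slot, so that the transition law, the update
probabilities and the moments of the load all become statements about one probability space. -/
theorem slot_eq_map_outcome (z : State M N) :
    slot A S P z = (outcome A S P z).map fun x => (x.2.2.2.1, x.next z) := by
  simp only [slot, outcome, PMF.map_bind, PMF.map_comp]
  rfl

theorem step_eq_map_outcome (z : State M N) :
    step A S P z = (outcome A S P z).map (Outcome.next z) := by
  rw [step, slot_eq_map_outcome, PMF.map_comp]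
  rfl

/-- Once choices and updates are forgotten, the law no longer depends on `z`. This is the source of
the independence of the net arrivals from the state. -/
theorem map_outcome_arrivals_services (z : State M N) :
    (outcome A S P z).map (fun x => (x.1, x.2.2.1))
      = A.bind fun a => (indep S).map (Prod.mk a) := by
  simp only [outcome, PMF.map_bind, PMF.map_comp]
  congr 1
  funext a
  have : ∀ (r : Fin M → Fin N) (s : Fin N → ℕ),
      PMF.map ((fun x : Outcome M N => (x.1, x.2.2.1)) ∘ fun w => (a, r, s, w)) (P.update z a r s)
        = PMF.pure (a, s) := fun r s => PMF.map_const _ (a, s)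
  simp_rw [this, PMF.bind_const]
  rfl

theorem map_outcome_arrivals_choices (z : State M N) :
    (outcome A S P z).map (fun x => (x.1, x.2.1))
      = A.bind fun a => (indep fun m => P.dispatch m (z.est m)).map (Prod.mk a) := by
  simp only [outcome, PMF.map_bind, PMF.map_comp]
  congr 1
  funext a
  have : ∀ (r : Fin M → Fin N) (s : Fin N → ℕ),
      PMF.map ((fun x : Outcome M N => (x.1, x.2.1)) ∘ fun w => (a, r, s, w)) (P.update z a r s)
        = PMF.pure (a, r) := fun r s => PMF.map_const _ (a, r)
  simp_rw [this, PMF.bind_const]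
  rfl

theorem toMeasure_map_outcome_arrivals_services (z : State M N) :
    ((outcome A S P z).map (fun x => (x.1, x.2.2.1))).toMeasure
      = A.toMeasure.prod (Measure.pi fun n => (S n).toMeasure) := by
  rw [map_outcome_arrivals_services, toMeasure_bind_map_prodMk, toMeasure_indep_nat]

theorem toMeasure_map_outcome_arrivals_choices (z : State M N) :
    ((outcome A S P z).map (fun x => (x.1, x.2.1))).toMeasure
      = A.toMeasure.prod (Measure.pi fun m => (P.dispatch m (z.est m)).toMeasure) := by
  rw [map_outcome_arrivals_choices, toMeasure_bind_map_prodMk, toMeasure_indep_fin]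

theorem mem_support_outcome {z : State M N} {x : Outcome M N}
    (hx : x ∈ (outcome A S P z).support) :
    x.2.2.2 ∈ (P.update z x.1 x.2.1 x.2.2.1).support := by
  simp only [outcome, PMF.mem_support_bind_iff, PMF.mem_support_map_iff] at hx
  obtain ⟨a, -, r, -, s, -, w, hw, rfl⟩ := hx
  exact hw

theorem updateProb_eq (z : State M N) (m : Fin M) (n : Fin N) :
    updateProb A S P z m n = (outcome A S P z).toMeasure {x | x.2.2.2.1 m n = true} := by
  have h : (slot A S P z).map (fun w => w.1 m n)
      = (outcome A S P z).map fun x => x.2.2.2.1 m n := by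
    rw [slot_eq_map_outcome, PMF.map_comp]
    rfl
  rw [updateProb, h, ← PMF.toMeasure_apply_singleton _ true (measurableSet_singleton _),
    PMF.toMeasure_map_apply _ _ _ (measurable_of_countable _) (measurableSet_singleton _)]
  rfl

theorem map_outcome_service (z : State M N) (n : Fin N) :
    (outcome A S P z).map (fun x => x.2.2.1 n) = S n := by
  have h : (outcome A S P z).map (fun x => x.2.2.1 n)
      = ((outcome A S P z).map (fun x => (x.1, x.2.2.1))).map (fun y => y.2 n) := by
    rw [PMF.map_comp]; rfl
  rw [← PMF.toMeasure_inj, h, ← PMF.toMeasure_map _ _ (measurable_of_countable _),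
    toMeasure_map_outcome_arrivals_services]
  have h2 : (fun y : (Fin M → ℕ) × (Fin N → ℕ) => y.2 n)
      = (fun s : Fin N → ℕ => s n) ∘ Prod.snd := rfl
  rw [h2, ← Measure.map_map (measurable_of_countable _) (measurable_of_countable _),
    ← Measure.snd, Measure.snd_prod]
  exact (measurePreserving_eval _ n).map_eq

theorem map_outcome_arrivals (z : State M N) : (outcome A S P z).map (fun x => x.1) = A := by
  simp only [outcome, PMF.map_bind, PMF.map_comp]
  have : ∀ (a : Fin M → ℕ) (r : Fin M → Fin N) (s : Fin N → ℕ),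
      PMF.map ((fun x : Outcome M N => x.1) ∘ fun w => (a, r, s, w)) (P.update z a r s)
        = PMF.pure a := fun a r s => PMF.map_const _ _
  simp_rw [this, PMF.bind_const, PMF.bind_pure]

theorem integral_service (z : State M N) (n : Fin N) :
    ∫ x, (x.2.2.1 n : ℝ) ∂(outcome A S P z).toMeasure = mean (S n) := by
  rw [mean, ← map_outcome_service A S P z n, integral_toMeasure_map]

/-- Mean number of arrivals at dispatcher `m`. -/
def arrivalMean (m : Fin M) : ℝ := ∫ a, (a m : ℝ) ∂A.toMeasure

theorem arrivalMean_nonneg (m : Fin M) : 0 ≤ arrivalMean A m :=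
  integral_nonneg fun _ => Nat.cast_nonneg _

/-- The choice of dispatcher `m` is independent of the arrivals, so the mean factorises; the
arrivals at different dispatchers may be dependent. -/
theorem integral_arrivalFrom (z : State M N) (m : Fin M) (n : Fin N) :
    ∫ x, (arrivalFrom x.1 x.2.1 m n : ℝ) ∂(outcome A S P z).toMeasure
      = arrivalMean A m * (P.dispatch m (z.est m) n).toReal := by
  have h := integral_toMeasure_map (outcome A S P z) (fun x => (x.1, x.2.1))
    (fun y => (y.1 m : ℝ) * (if y.2 m = n then 1 else 0))
  have h1 : ∀ x : Outcome M N, (arrivalFrom x.1 x.2.1 m n : ℝ)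
      = (x.1 m : ℝ) * (if x.2.1 m = n then 1 else 0) := fun x => by
    simp [arrivalFrom]
  simp_rw [h1]
  rw [← h, toMeasure_map_outcome_arrivals_choices,
    integral_prod_mul (μ := A.toMeasure) (fun a : Fin M → ℕ => (a m : ℝ))
      (fun r : Fin M → Fin N => if r m = n then (1 : ℝ) else 0), arrivalMean]
  congr 1
  have h2 := integral_comp_eval (μ := fun m => (P.dispatch m (z.est m)).toMeasure) (i := m)
    (f := fun r : Fin N => if r = n then (1 : ℝ) else 0)
    (measurable_of_countable _).aestronglyMeasurable
  rw [h2, PMF.integral_eq_sum]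
  simp

theorem mean_totalArrival :
    mean (totalArrival A) = ∫ a, ∑ m, (a m : ℝ) ∂A.toMeasure := by
  rw [mean, totalArrival, integral_toMeasure_map]
  simp

end Chain

/-! ### Partial projections -/

section Projection

variable {N : ℕ}

/-- For `κ = 0` the vector itself, for `κ = 1` its deviation from the mean of its entries. -/
def deviation (κ : ℝ) (v : Fin N → ℝ) (n : Fin N) : ℝ := v n - κ * ((∑ i, v i) / N)

theorem deviation_add (κ : ℝ) (v d : Fin N → ℝ) (n : Fin N) :
    deviation κ (v + d) n = deviation κ v n + deviation κ d n := by
  simp only [deviation, Pi.add_apply, Finset.sum_add_distrib]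
  ring

theorem sum_deviation [NeZero N] (κ : ℝ) (v : Fin N → ℝ) :
    ∑ n, deviation κ v n = (1 - κ) * ∑ n, v n := by
  have hN : (N : ℝ) ≠ 0 := Nat.cast_ne_zero.2 (NeZero.ne N)
  simp only [deviation, Finset.sum_sub_distrib, Finset.sum_const, Finset.card_univ,
    Fintype.card_fin, nsmul_eq_mul]
  field_simp

/-- For both values of `κ`, `deviation κ` is an orthogonal projection, that is, self-adjoint and
idempotent. -/
theorem sum_deviation_mul_deviation [NeZero N] {κ : ℝ} (hκ : κ = 0 ∨ κ = 1) (v d : Fin N → ℝ) :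
    ∑ n, deviation κ v n * deviation κ d n = ∑ n, deviation κ v n * d n := by
  have h : ∀ n, deviation κ v n * deviation κ d n
      = deviation κ v n * d n - deviation κ v n * (κ * ((∑ i, d i) / N)) := fun n => by
    rw [deviation, deviation]; ring
  simp_rw [h]
  rw [Finset.sum_sub_distrib, ← Finset.sum_mul, sum_deviation]
  rcases hκ with rfl | rfl <;> ring

theorem sum_sq_deviation_le [NeZero N] {κ : ℝ} (hκ : κ = 0 ∨ κ = 1) (d : Fin N → ℝ) :
    ∑ n, deviation κ d n ^ 2 ≤ ∑ n, d n ^ 2 := by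
  have h := sum_deviation_mul_deviation hκ d d
  simp_rw [← sq] at h
  have h2 : ∑ n, deviation κ d n * d n = ∑ n, d n ^ 2 - κ * (∑ n, d n) ^ 2 / N := by
    simp_rw [deviation, sub_mul, ← sq]
    rw [Finset.sum_sub_distrib, ← Finset.mul_sum]
    ring
  rw [h, h2]
  have : 0 ≤ κ * (∑ n, d n) ^ 2 / N := by rcases hκ with rfl | rfl <;> positivity
  linarith

theorem sum_sq_deviation_add [NeZero N] {κ : ℝ} (hκ : κ = 0 ∨ κ = 1) (v d : Fin N → ℝ) :
    ∑ n, deviation κ (v + d) n ^ 2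
      = ∑ n, deviation κ v n ^ 2 + 2 * ∑ n, deviation κ v n * d n
        + ∑ n, deviation κ d n ^ 2 := by
  rw [← sum_deviation_mul_deviation hκ, Finset.mul_sum, ← Finset.sum_add_distrib,
    ← Finset.sum_add_distrib]
  exact Finset.sum_congr rfl fun n _ => by rw [deviation_add]; ring

theorem abs_deviation_le_sqrt (κ : ℝ) (v : Fin N → ℝ) (n : Fin N) :
    |deviation κ v n| ≤ √(∑ i, deviation κ v i ^ 2) := by
  refine Real.abs_le_sqrt ?_
  exact Finset.single_le_sum (f := fun i => deviation κ v i ^ 2) (fun i _ => sq_nonneg _)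
    (Finset.mem_univ n)

/-- The deviation from the mean is controlled by the range. -/
theorem sqrt_sum_sq_deviation_one_le [NeZero N] (v : Fin N → ℝ) :
    ∃ a b, √(∑ n, deviation 1 v n ^ 2) ≤ N * (v a - v b) := by
  obtain ⟨a, ha⟩ := Finite.exists_max v
  obtain ⟨b, hb⟩ := Finite.exists_min v
  refine ⟨a, b, ?_⟩
  have hN : (0 : ℝ) < N := Nat.cast_pos.2 (NeZero.pos N)
  have hN1 : (1 : ℝ) ≤ N := Nat.one_le_cast.2 (NeZero.pos N)
  have hab : 0 ≤ v a - v b := sub_nonneg.2 (ha b)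
  have hup : (∑ i, v i) / N ≤ v a := by
    rw [div_le_iff₀ hN]
    calc ∑ i, v i ≤ ∑ _i : Fin N, v a := Finset.sum_le_sum fun i _ => ha i
      _ = _ := by simp [mul_comm]
  have hlo : v b ≤ (∑ i, v i) / N := by
    rw [le_div_iff₀ hN]
    calc v b * N = ∑ _i : Fin N, v b := by simp [mul_comm]
      _ ≤ ∑ i, v i := Finset.sum_le_sum fun i _ => hb i
  rw [Real.sqrt_le_left (by positivity)]
  calc ∑ n, deviation 1 v n ^ 2 ≤ ∑ _n : Fin N, (v a - v b) ^ 2 := by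
        refine Finset.sum_le_sum fun n _ => sq_le_sq' ?_ ?_ <;> simp only [deviation, one_mul]
        · linarith [hb n]
        · linarith [ha n]
    _ = N * (v a - v b) ^ 2 := by simp
    _ ≤ N * (N * (v a - v b) ^ 2) := by
        gcongr
        exact le_mul_of_one_le_left (sq_nonneg _) hN1
    _ = _ := by ring

theorem sqrt_sum_sq_deviation_zero_le (v : Fin N → ℝ) (hv : ∀ n, 0 ≤ v n) :
    √(∑ n, deviation 0 v n ^ 2) ≤ ∑ n, v n := by
  rw [Real.sqrt_le_left (Finset.sum_nonneg fun n _ => hv n)]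
  simp only [deviation, zero_mul, sub_zero]
  exact Finset.sum_sq_le_sq_sum_of_nonneg fun n _ => hv n

end Projection

/-! ### Tilted preferences -/

/-- As `D` sums to zero, `g` may be recentred at its value `c` in position `k`, where `D` changes
sign. All the products `(c - g i) * D i` are then nonnegative, and the two extreme ones alone
contribute at least `δ` times the range of `g`. -/
theorem sum_mul_le_of_tilted {N k : ℕ} {δ : ℝ} {g D : Fin N → ℝ} (hg : Monotone g) (hk : 2 ≤ k)
    (hkN : k ≤ N) (hD : ∑ i, D i = 0)
    (h : ∀ i : Fin N, ((i : ℕ) + 1 < k → 0 ≤ D i) ∧ (k ≤ (i : ℕ) + 1 → D i ≤ 0) ∧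
      ((i : ℕ) + 1 = 1 → δ ≤ D i) ∧ ((i : ℕ) + 1 = N → D i ≤ -δ)) (a b : Fin N) (hδ : 0 ≤ δ) :
    ∑ i, g i * D i ≤ -δ * (g a - g b) := by
  -- Positions are counted from one, so position `k` has index `k - 1`.
  set c := g ⟨k - 1, by omega⟩ with hc
  let i0 : Fin N := ⟨0, by omega⟩
  let i1 : Fin N := ⟨N - 1, by omega⟩
  have hsum : ∑ i, g i * D i = -∑ i, (c - g i) * D i := by
    simp_rw [sub_mul]
    rw [Finset.sum_sub_distrib, ← Finset.mul_sum, hD]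
    ring
  have hterm : ∀ i, 0 ≤ (c - g i) * D i := by
    intro i
    rcases lt_or_ge ((i : ℕ) + 1) k with hi | hi
    · refine mul_nonneg (sub_nonneg.2 (hg ?_)) ((h i).1 hi)
      rw [Fin.le_def]
      simp only
      omega
    · refine mul_nonneg_of_nonpos_of_nonpos (sub_nonpos.2 (hg ?_)) ((h i).2.1 hi)
      rw [Fin.le_def]
      simp only
      omega
  -- Distinct because `2 ≤ k ≤ N`; otherwise the two extreme terms could not both be counted.
  have hne : i0 ≠ i1 := by
    simp only [i0, i1, ne_eq, Fin.mk.injEq]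
    omega
  have h2 : (c - g i0) * D i0 + (c - g i1) * D i1 ≤ ∑ i, (c - g i) * D i :=
    Finset.add_le_sum (f := fun i => (c - g i) * D i) (fun i _ => hterm i) (Finset.mem_univ _)
      (Finset.mem_univ _) hne
  have h0 : g i0 ≤ c := hg (by rw [Fin.le_def]; simp [i0])
  have h1 : c ≤ g i1 := hg (by rw [Fin.le_def]; simp only [i1]; omega)
  have hd0 : δ ≤ D i0 := (h i0).2.2.1 (by simp [i0])
  have hd1 : D i1 ≤ -δ := (h i1).2.2.2 (by simp only [i1]; omega)
  have ha : g a ≤ g i1 := hg (by rw [Fin.le_def]; simp only [i1]; omega)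
  have hb : g i0 ≤ g b := hg (by rw [Fin.le_def]; simp [i0])
  rw [hsum]
  nlinarith [mul_le_mul_of_nonneg_left hd0 (sub_nonneg.2 h0),
    mul_le_mul_of_nonneg_left (neg_le_neg hd1) (sub_nonneg.2 h1),
    mul_le_mul_of_nonneg_left ha hδ, mul_le_mul_of_nonneg_left hb hδ]

/-! ### Deterministic bounds on one slot -/

section Slot

variable {M N : ℕ}

/-- Queue lengths as a real vector. -/
def State.q (z : State M N) (n : Fin N) : ℝ := z.queue n

/-- Error of the estimate of dispatcher `m` for server `n`. -/
def State.err (z : State M N) (m : Fin M) (n : Fin N) : ℝ := |(z.queue n : ℝ) - z.est m n|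

/-- Sum of all the estimation errors. -/
def State.errSum (z : State M N) : ℝ := ∑ m, ∑ n, z.err m n

/-- Squared norm of the queue lengths (`κ = 0`), or of their deviation from the mean (`κ = 1`). -/
def State.spread (κ : ℝ) (z : State M N) : ℝ := ∑ n, deviation κ z.q n ^ 2

theorem State.err_nonneg (z : State M N) (m : Fin M) (n : Fin N) : 0 ≤ z.err m n := abs_nonneg _

theorem State.spread_nonneg (κ : ℝ) (z : State M N) : 0 ≤ z.spread κ :=
  Finset.sum_nonneg fun _ _ => sq_nonneg _

theorem State.q_nonneg (z : State M N) (n : Fin N) : 0 ≤ z.q n := Nat.cast_nonneg _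

/-- Unused service of server `n`. -/
def Outcome.unused (z : State M N) (x : Outcome M N) (n : Fin N) : ℝ :=
  (x.next z).q n - (z.q n + (arrivalTo x.1 x.2.1 n : ℝ) - x.2.2.1 n)

theorem Outcome.q_next (z : State M N) (x : Outcome M N) (n : Fin N) :
    (x.next z).q n = max (z.q n + (arrivalTo x.1 x.2.1 n : ℝ) - x.2.2.1 n) 0 := by
  simp only [State.q, Outcome.next, nextQueue]
  rcases le_total (x.2.2.1 n) (z.queue n + arrivalTo x.1 x.2.1 n) with h | h
  · rw [Nat.cast_sub h, max_eq_left]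
    · push_cast; ring
    · have : (x.2.2.1 n : ℝ) ≤ (z.queue n + arrivalTo x.1 x.2.1 n : ℕ) := Nat.cast_le.2 h
      push_cast at this
      linarith
  · rw [Nat.sub_eq_zero_of_le h, max_eq_right, Nat.cast_zero]
    have : ((z.queue n + arrivalTo x.1 x.2.1 n : ℕ) : ℝ) ≤ x.2.2.1 n := Nat.cast_le.2 h
    push_cast at this
    linarith

theorem Outcome.unused_nonneg (z : State M N) (x : Outcome M N) (n : Fin N) :
    0 ≤ x.unused z n := by
  rw [Outcome.unused, Outcome.q_next]
  linarith [le_max_left (z.q n + (arrivalTo x.1 x.2.1 n : ℝ) - x.2.2.1 n) 0]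

theorem Outcome.unused_le (z : State M N) (x : Outcome M N) (n : Fin N) :
    x.unused z n ≤ x.2.2.1 n := by
  rw [Outcome.unused, Outcome.q_next, sub_le_iff_le_add]
  have h1 := z.q_nonneg n
  have h2 : (0 : ℝ) ≤ arrivalTo x.1 x.2.1 n := Nat.cast_nonneg _
  have h3 : (0 : ℝ) ≤ x.2.2.1 n := Nat.cast_nonneg _
  refine max_le ?_ ?_ <;> linarith

theorem Outcome.unused_mul_next (z : State M N) (x : Outcome M N) (n : Fin N) :
    x.unused z n * (x.next z).q n = 0 := by
  rw [Outcome.unused, Outcome.q_next]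
  rcases le_total (z.q n + (arrivalTo x.1 x.2.1 n : ℝ) - x.2.2.1 n) 0 with h | h
  · rw [max_eq_right h, mul_zero]
  · rw [max_eq_left h, sub_self, zero_mul]

/-- Unused service occurs only if the queue ends empty. Expanding `unused * next = 0` expresses the
product with the present queue as `unused * service` minus nonnegative terms. -/
theorem Outcome.unused_mul_le (z : State M N) (x : Outcome M N) (n : Fin N) :
    x.unused z n * z.q n ≤ (x.2.2.1 n : ℝ) ^ 2 := by
  have h0 := x.unused_mul_next z n
  have h1 := x.unused_nonneg z n
  have h2 := x.unused_le z n
  have h3 : (0 : ℝ) ≤ arrivalTo x.1 x.2.1 n := Nat.cast_nonneg _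
  have h4 : (0 : ℝ) ≤ x.2.2.1 n := Nat.cast_nonneg _
  have h5 : (x.next z).q n
      = z.q n + (arrivalTo x.1 x.2.1 n : ℝ) - x.2.2.1 n + x.unused z n := by
    rw [Outcome.unused]; ring
  have h6 : x.unused z n * z.q n = x.unused z n * x.2.2.1 n
      - x.unused z n * arrivalTo x.1 x.2.1 n - x.unused z n ^ 2 := by
    rw [h5] at h0; linarith
  nlinarith [mul_nonneg h1 h3, mul_le_mul_of_nonneg_right h2 h4, sq_nonneg (x.unused z n)]

theorem sum_arrivalTo (a : Fin M → ℕ) (r : Fin M → Fin N) :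
    ∑ n, (arrivalTo a r n : ℝ) = ∑ m, (a m : ℝ) := by
  simp only [arrivalTo, arrivalFrom]
  push_cast
  rw [Finset.sum_comm]
  simp

theorem arrivalFrom_le_arrivalTo (a : Fin M → ℕ) (r : Fin M → Fin N) (m : Fin M) (n : Fin N) :
    (arrivalFrom a r m n : ℝ) ≤ arrivalTo a r n := by
  exact_mod_cast Finset.single_le_sum (f := fun m => arrivalFrom a r m n) (fun _ _ => Nat.zero_le _)
    (Finset.mem_univ m)

theorem arrivalTo_le (a : Fin M → ℕ) (r : Fin M → Fin N) (n : Fin N) :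
    (arrivalTo a r n : ℝ) ≤ ∑ m, (a m : ℝ) := by
  rw [← sum_arrivalTo a r]
  exact Finset.single_le_sum (f := fun n => (arrivalTo a r n : ℝ)) (fun _ _ => Nat.cast_nonneg _)
    (Finset.mem_univ n)

theorem Outcome.service_le_sum (x : Outcome M N) (n : Fin N) :
    (x.2.2.1 n : ℝ) ≤ ∑ n, (x.2.2.1 n : ℝ) :=
  Finset.single_le_sum (f := fun n => (x.2.2.1 n : ℝ)) (fun _ _ => Nat.cast_nonneg _)
    (Finset.mem_univ n)

theorem Outcome.one_le_load (x : Outcome M N) : 1 ≤ x.load := by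
  have h1 : 0 ≤ ∑ m, (x.1 m : ℝ) := Finset.sum_nonneg fun _ _ => Nat.cast_nonneg _
  have h2 : 0 ≤ ∑ n, (x.2.2.1 n : ℝ) := Finset.sum_nonneg fun _ _ => Nat.cast_nonneg _
  rw [Outcome.load]
  linarith

theorem Outcome.arrivalTo_add_service_le_load (x : Outcome M N) (n : Fin N) :
    (arrivalTo x.1 x.2.1 n : ℝ) + x.2.2.1 n ≤ x.load := by
  rw [Outcome.load]
  linarith [arrivalTo_le x.1 x.2.1 n, x.service_le_sum n]

/-- Change of the length of queue `n` during the slot. -/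
def Outcome.increment (z : State M N) (x : Outcome M N) (n : Fin N) : ℝ :=
  (x.next z).q n - z.q n

theorem Outcome.increment_eq (z : State M N) (x : Outcome M N) (n : Fin N) :
    x.increment z n = (arrivalTo x.1 x.2.1 n : ℝ) - x.2.2.1 n + x.unused z n := by
  rw [Outcome.increment, Outcome.unused]; ring

theorem Outcome.abs_increment_le (z : State M N) (x : Outcome M N) (n : Fin N) :
    |x.increment z n| ≤ x.load := by
  have h1 := x.unused_nonneg z n
  have h2 := x.unused_le z n
  have h3 := x.arrivalTo_add_service_le_load n
  have h4 : (0 : ℝ) ≤ arrivalTo x.1 x.2.1 n := Nat.cast_nonneg _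
  have h5 : (0 : ℝ) ≤ x.2.2.1 n := Nat.cast_nonneg _
  rw [x.increment_eq, abs_le]
  constructor <;> linarith

theorem Outcome.q_next_eq_add (z : State M N) (x : Outcome M N) :
    (x.next z).q = z.q + x.increment z := by
  funext n
  simp [Outcome.increment]

theorem Outcome.sum_sq_increment_le (z : State M N) (x : Outcome M N) :
    ∑ n, x.increment z n ^ 2 ≤ N * x.load ^ 2 := by
  calc ∑ n, x.increment z n ^ 2 ≤ ∑ _n : Fin N, x.load ^ 2 :=
        Finset.sum_le_sum fun n _ => sq_le_sq' (abs_le.1 (x.abs_increment_le z n)).1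
          (abs_le.1 (x.abs_increment_le z n)).2
    _ = _ := by simp

/-- In the expansion of the square, the unused service is paired with the deviation, which is at
most the queue length because the mean is nonnegative; `Outcome.unused_mul_le` then bounds that
pairing independently of the state. It accounts for the 2 in `2 + N`, and the squared increment for
the `N`. -/
theorem Outcome.spread_next_le [NeZero N] {κ : ℝ} (hκ : κ = 0 ∨ κ = 1) (z : State M N)
    (x : Outcome M N) :
    (x.next z).spread κ ≤ z.spread κ
      + 2 * ∑ n, deviation κ z.q n * ((arrivalTo x.1 x.2.1 n : ℝ) - x.2.2.1 n)
      + (2 + N) * x.load ^ 2 := by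
  have h1 := sum_sq_deviation_add hκ z.q (x.increment z)
  have h2 := sum_sq_deviation_le hκ (x.increment z)
  have h3 := x.sum_sq_increment_le z
  have h4 : ∑ n, deviation κ z.q n * x.unused z n ≤ x.load ^ 2 := by
    calc ∑ n, deviation κ z.q n * x.unused z n ≤ ∑ n, (x.2.2.1 n : ℝ) ^ 2 := by
          refine Finset.sum_le_sum fun n _ => le_trans ?_ (x.unused_mul_le z n)
          rw [mul_comm]
          refine mul_le_mul_of_nonneg_left ?_ (x.unused_nonneg z n)
          have : 0 ≤ κ * ((∑ i, z.q i) / N) := by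
            have := Finset.sum_nonneg fun i (_ : i ∈ Finset.univ) => z.q_nonneg i
            rcases hκ with rfl | rfl <;> positivity
          rw [deviation]
          linarith
      _ ≤ (∑ n, (x.2.2.1 n : ℝ)) ^ 2 :=
          Finset.sum_sq_le_sq_sum_of_nonneg fun n _ => Nat.cast_nonneg _
      _ ≤ x.load ^ 2 := by
          have h1 : 0 ≤ ∑ m, (x.1 m : ℝ) := Finset.sum_nonneg fun _ _ => Nat.cast_nonneg _
          have h2 : 0 ≤ ∑ n, (x.2.2.1 n : ℝ) := Finset.sum_nonneg fun _ _ => Nat.cast_nonneg _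
          refine pow_le_pow_left₀ h2 ?_ 2
          rw [Outcome.load]
          linarith
  have h5 : ∑ n, deviation κ z.q n * x.increment z n
      = ∑ n, deviation κ z.q n * ((arrivalTo x.1 x.2.1 n : ℝ) - x.2.2.1 n)
        + ∑ n, deviation κ z.q n * x.unused z n := by
    rw [← Finset.sum_add_distrib]
    exact Finset.sum_congr rfl fun n _ => by rw [x.increment_eq]; ring
  rw [State.spread, State.spread, x.q_next_eq_add, h1, h5]
  linarith

/-- A two-sided bound without sign information, of the order of the norm rather than its square. It
controls the quadratic term in the drift of `spread ^ 2`, and the integrability of `spread` after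
the slot. -/
theorem Outcome.abs_spread_next_sub_le [NeZero N] {κ : ℝ} (hκ : κ = 0 ∨ κ = 1) (z : State M N)
    (x : Outcome M N) :
    |(x.next z).spread κ - z.spread κ| ≤ 2 * N * √(z.spread κ) * x.load + N * x.load ^ 2 := by
  have h1 := sum_sq_deviation_add hκ z.q (x.increment z)
  have h2 := sum_sq_deviation_le hκ (x.increment z)
  have h3 := x.sum_sq_increment_le z
  have h4 : |∑ n, deviation κ z.q n * x.increment z n| ≤ N * √(z.spread κ) * x.load := by
    calc _ ≤ ∑ n, |deviation κ z.q n * x.increment z n| := Finset.abs_sum_le_sum_abs _ _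
      _ ≤ ∑ _n : Fin N, √(z.spread κ) * x.load := by
          refine Finset.sum_le_sum fun n _ => ?_
          rw [abs_mul]
          exact mul_le_mul (abs_deviation_le_sqrt κ z.q n) (x.abs_increment_le z n) (abs_nonneg _)
            (Real.sqrt_nonneg _)
      _ = _ := by simp [mul_assoc]
  have h5 : 0 ≤ ∑ n, deviation κ (x.increment z) n ^ 2 := Finset.sum_nonneg fun _ _ => sq_nonneg _
  have h6 := abs_le.1 h4
  rw [State.spread, State.spread, x.q_next_eq_add, h1, abs_le]
  rw [State.spread] at h6
  constructor <;> nlinarith [h6.1, h6.2]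

end Slot

/-! ### Evolution of the estimation errors -/

section Policy

variable {M N : ℕ} (P : Policy M N)

/-- Without an update, the queue and its estimate each move by a bounded amount: the estimate rises
by at most the tasks sent by that dispatcher, which are among the arrivals at the queue. -/
theorem Policy.err_next_le {z : State M N} {x : Outcome M N}
    (hx : x.2.2.2 ∈ (P.update z x.1 x.2.1 x.2.2.1).support) (m : Fin M) (n : Fin N) :
    (x.next z).err m n ≤ if x.2.2.2.1 m n = true then 0 else z.err m n + x.load := by
  split_ifs with h
  · have := P.est_of_updated z x.1 x.2.1 x.2.2.1 x.2.2.2 hx m n h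
    simp [State.err, Outcome.next, this]
  · have h1 := P.est_of_not_updated z x.1 x.2.1 x.2.2.1 x.2.2.2 hx m n (by simpa using h)
    have h2 : (z.est m n : ℝ) ≤ x.2.2.2.2 m n := Nat.cast_le.2 h1.1
    have h3 : (x.2.2.2.2 m n : ℝ) ≤ z.est m n + arrivalFrom x.1 x.2.1 m n := by
      exact_mod_cast h1.2
    have h4 := arrivalFrom_le_arrivalTo x.1 x.2.1 m n
    have h5 := x.arrivalTo_add_service_le_load n
    have h6 := x.unused_nonneg z n
    have h7 := x.unused_le z n
    have h8 : ((x.next z).queue n : ℝ) = z.queue n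
        + ((arrivalTo x.1 x.2.1 n : ℝ) - x.2.2.1 n + x.unused z n) := by
      rw [← x.increment_eq]; simp [Outcome.increment, State.q]
    have h10 : (0 : ℝ) ≤ x.2.2.1 n := Nat.cast_nonneg _
    have h11 : (0 : ℝ) ≤ arrivalTo x.1 x.2.1 n := Nat.cast_nonneg _
    have h12 : (x.next z).est m n = x.2.2.2.2 m n := rfl
    have h13 := neg_abs_le ((z.queue n : ℝ) - z.est m n)
    have h14 := le_abs_self ((z.queue n : ℝ) - z.est m n)
    rw [State.err, State.err, h12, h8, abs_le]
    constructor <;> linarith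

end Policy

/-! ### Moments of the load of a slot -/

section Moments

variable {M N : ℕ} (A : PMF (Fin M → ℕ)) (S : Fin N → PMF ℕ) (P : Policy M N)

theorem Outcome.load_pow_four_le (x : Outcome M N) :
    x.load ^ 4 ≤ 27 * (1 + (∑ m, (x.1 m : ℝ)) ^ 4 + N ^ 3 * ∑ n, (x.2.2.1 n : ℝ) ^ 4) := by
  have h1 : (∑ n, (x.2.2.1 n : ℝ)) ^ 4 ≤ N ^ 3 * ∑ n, (x.2.2.1 n : ℝ) ^ 4 := by
    have := pow_sum_le_card_mul_sum_pow (s := (Finset.univ : Finset (Fin N)))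
      (f := fun n => (x.2.2.1 n : ℝ)) (fun _ _ => Nat.cast_nonneg _) 3
    simpa using this
  have h2 : ∀ a s : ℝ, (1 + (a + s)) ^ 4 ≤ 27 * (1 + a ^ 4 + s ^ 4) := fun a s => by
    have h3 : (1 + (a + s)) ^ 2 ≤ 3 * (1 + a ^ 2 + s ^ 2) := by
      nlinarith [sq_nonneg (a - 1), sq_nonneg (s - 1), sq_nonneg (a - s)]
    calc (1 + (a + s)) ^ 4 = ((1 + (a + s)) ^ 2) ^ 2 := by ring
      _ ≤ (3 * (1 + a ^ 2 + s ^ 2)) ^ 2 := pow_le_pow_left₀ (sq_nonneg _) h3 2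
      _ ≤ _ := by
        nlinarith [sq_nonneg (a ^ 2 - 1), sq_nonneg (s ^ 2 - 1), sq_nonneg (a ^ 2 - s ^ 2)]
  rw [Outcome.load]
  refine (h2 _ _).trans ?_
  gcongr

/-- Bound for the fourth moment of the load. -/
def loadBound (N : ℕ) (θ₁ D₁ θ₂ D₂ : ℝ) : ℝ :=
  27 * (1 + 24 / θ₁ ^ 4 * |D₁| + N ^ 3 * ∑ _n : Fin N, 24 / θ₂ ^ 4 * |D₂|)

theorem loadBound_nonneg (N : ℕ) {θ₁ θ₂ : ℝ} (D₁ D₂ : ℝ) : 0 ≤ loadBound N θ₁ D₁ θ₂ D₂ := by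
  unfold loadBound
  positivity

theorem lintegral_load_pow_four_le {θ₁ D₁ θ₂ D₂ : ℝ} (hθ₁ : 0 < θ₁) (hθ₂ : 0 < θ₂)
    (hA : ExpMomentLE (totalArrival A) θ₁ D₁) (hS : ∀ n, ExpMomentLE (S n) θ₂ D₂)
    (z : State M N) :
    ∫⁻ x, ENNReal.ofReal (x.load ^ 4) ∂(outcome A S P z).toMeasure
      ≤ ENNReal.ofReal (loadBound N θ₁ D₁ θ₂ D₂) := by
  have hA' : ∫⁻ x, ENNReal.ofReal ((∑ m, (x.1 m : ℝ)) ^ 4) ∂(outcome A S P z).toMeasure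
      ≤ ENNReal.ofReal (24 / θ₁ ^ 4 * |D₁|) := by
    refine le_trans (le_of_eq ?_) ((hA.lintegral_pow_four_le hθ₁).trans (ENNReal.ofReal_le_ofReal
      (mul_le_mul_of_nonneg_left (le_abs_self _) (by positivity))))
    conv_rhs => rw [totalArrival, ← map_outcome_arrivals A S P z]
    rw [lintegral_toMeasure_map, lintegral_toMeasure_map]
    simp
  have hS' : ∀ n, ∫⁻ x, ENNReal.ofReal ((x.2.2.1 n : ℝ) ^ 4) ∂(outcome A S P z).toMeasure
      ≤ ENNReal.ofReal (24 / θ₂ ^ 4 * |D₂|) := fun n => by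
    refine le_trans (le_of_eq ?_) (((hS n).lintegral_pow_four_le hθ₂).trans
      (ENNReal.ofReal_le_ofReal (mul_le_mul_of_nonneg_left (le_abs_self _) (by positivity))))
    conv_rhs => rw [← map_outcome_service A S P z n]
    rw [lintegral_toMeasure_map]
  set μ := (outcome A S P z).toMeasure
  have hsplit : ∀ x : Outcome M N, ENNReal.ofReal (x.load ^ 4)
      ≤ ENNReal.ofReal 27 * (1 + ENNReal.ofReal ((∑ m, (x.1 m : ℝ)) ^ 4)
        + ENNReal.ofReal (N ^ 3) * ∑ n, ENNReal.ofReal ((x.2.2.1 n : ℝ) ^ 4)) := fun x => by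
    refine (ENNReal.ofReal_le_ofReal x.load_pow_four_le).trans (le_of_eq ?_)
    rw [ENNReal.ofReal_mul (by norm_num), ENNReal.ofReal_add (by positivity) (by positivity),
      ENNReal.ofReal_add (by positivity) (by positivity), ENNReal.ofReal_one,
      ENNReal.ofReal_mul (by positivity), ENNReal.ofReal_sum_of_nonneg fun _ _ => by positivity]
  calc _ ≤ ∫⁻ x, ENNReal.ofReal 27 * (1 + ENNReal.ofReal ((∑ m, (x.1 m : ℝ)) ^ 4)
        + ENNReal.ofReal (N ^ 3) * ∑ n, ENNReal.ofReal ((x.2.2.1 n : ℝ) ^ 4)) ∂μ :=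
        lintegral_mono hsplit
    _ = ENNReal.ofReal 27 * (1 + ∫⁻ x, ENNReal.ofReal ((∑ m, (x.1 m : ℝ)) ^ 4) ∂μ
        + ENNReal.ofReal (N ^ 3) * ∑ n, ∫⁻ x, ENNReal.ofReal ((x.2.2.1 n : ℝ) ^ 4) ∂μ) := by
        rw [lintegral_const_mul _ (measurable_of_countable _),
          lintegral_add_left (measurable_of_countable _),
          lintegral_add_left (measurable_of_countable _),
          lintegral_const_mul _ (measurable_of_countable _),
          lintegral_finsetSum _ fun _ _ => measurable_of_countable _]
        simp [μ]
    _ ≤ ENNReal.ofReal 27 * (1 + ENNReal.ofReal (24 / θ₁ ^ 4 * |D₁|)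
        + ENNReal.ofReal (N ^ 3) * ∑ _n : Fin N, ENNReal.ofReal (24 / θ₂ ^ 4 * |D₂|)) := by
        gcongr with n
        exact hS' n
    _ = _ := by
        rw [loadBound, ENNReal.ofReal_mul (p := 27) (by norm_num),
          ENNReal.ofReal_add (by positivity) (by positivity),
          ENNReal.ofReal_add (by positivity) (by positivity), ENNReal.ofReal_one,
          ENNReal.ofReal_mul (p := (N : ℝ) ^ 3) (by positivity),
          ENNReal.ofReal_sum_of_nonneg fun _ _ => by positivity]

variable {A S P} {z : State M N} {B : ℝ}

/-- The summand 1 in the load makes its powers increasing in the exponent, so the fourth moment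
dominates the lower ones. -/
theorem integrable_load_pow
    (hB : ∫⁻ x, ENNReal.ofReal (x.load ^ 4) ∂(outcome A S P z).toMeasure ≤ ENNReal.ofReal B)
    {k : ℕ} (hk : k ≤ 4) : Integrable (fun x => x.load ^ k) (outcome A S P z).toMeasure := by
  refine integrable_of_abs_le (integrable_of_lintegral_le (fun x => by positivity) hB)
    (Eventually.of_forall fun x => ?_)
  have h := x.one_le_load
  rw [abs_of_nonneg (by positivity)]
  exact pow_le_pow_right₀ h hk

theorem integral_load_pow_le (hB0 : 0 ≤ B)
    (hB : ∫⁻ x, ENNReal.ofReal (x.load ^ 4) ∂(outcome A S P z).toMeasure ≤ ENNReal.ofReal B)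
    {k : ℕ} (hk : k ≤ 4) : ∫ x, x.load ^ k ∂(outcome A S P z).toMeasure ≤ B :=
  (integral_mono (integrable_load_pow hB hk) (integrable_load_pow hB le_rfl)
    fun x => pow_le_pow_right₀ x.one_le_load hk).trans
    (integral_le_of_lintegral_le (fun x => by positivity) hB0 hB)

theorem integrable_arrivalFrom
    (hB : ∫⁻ x, ENNReal.ofReal (x.load ^ 4) ∂(outcome A S P z).toMeasure ≤ ENNReal.ofReal B)
    (m : Fin M) (n : Fin N) :
    Integrable (fun x => (arrivalFrom x.1 x.2.1 m n : ℝ)) (outcome A S P z).toMeasure := by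
  refine integrable_of_abs_le (integrable_load_pow hB (k := 1) (by norm_num))
    (Eventually.of_forall fun x => ?_)
  have h1 := arrivalFrom_le_arrivalTo x.1 x.2.1 m n
  have h2 := x.arrivalTo_add_service_le_load n
  have h3 : (0 : ℝ) ≤ x.2.2.1 n := Nat.cast_nonneg _
  rw [abs_of_nonneg (Nat.cast_nonneg _), pow_one]
  linarith

theorem integrable_service
    (hB : ∫⁻ x, ENNReal.ofReal (x.load ^ 4) ∂(outcome A S P z).toMeasure ≤ ENNReal.ofReal B)
    (n : Fin N) :
    Integrable (fun x => (x.2.2.1 n : ℝ)) (outcome A S P z).toMeasure := by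
  refine integrable_of_abs_le (integrable_load_pow hB (k := 1) (by norm_num))
    (Eventually.of_forall fun x => ?_)
  have h2 := x.arrivalTo_add_service_le_load n
  have h3 : (0 : ℝ) ≤ arrivalTo x.1 x.2.1 n := Nat.cast_nonneg _
  rw [abs_of_nonneg (Nat.cast_nonneg _), pow_one]
  linarith

theorem integrable_arrivalTo
    (hB : ∫⁻ x, ENNReal.ofReal (x.load ^ 4) ∂(outcome A S P z).toMeasure ≤ ENNReal.ofReal B)
    (n : Fin N) :
    Integrable (fun x => (arrivalTo x.1 x.2.1 n : ℝ)) (outcome A S P z).toMeasure := by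
  simp only [arrivalTo, Nat.cast_sum]
  exact integrable_finsetSum _ fun m _ => integrable_arrivalFrom hB m n

variable (A S P z) in
/-- Expected arrivals minus expected services at server `n`, in state `z`. -/
def netRate (n : Fin N) : ℝ :=
  ∑ m, arrivalMean A m * (P.dispatch m (z.est m) n).toReal - mean (S n)

theorem integral_arrivalTo_sub_service
    (hB : ∫⁻ x, ENNReal.ofReal (x.load ^ 4) ∂(outcome A S P z).toMeasure ≤ ENNReal.ofReal B)
    (n : Fin N) :
    ∫ x, ((arrivalTo x.1 x.2.1 n : ℝ) - x.2.2.1 n) ∂(outcome A S P z).toMeasure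
      = netRate A S P z n := by
  rw [integral_sub (integrable_arrivalTo hB n) (integrable_service hB n), integral_service, netRate]
  congr 1
  simp only [arrivalTo, Nat.cast_sum]
  rw [integral_finsetSum _ fun m _ => integrable_arrivalFrom hB m n]
  exact Finset.sum_congr rfl fun m _ => integral_arrivalFrom A S P z m n

/-! ### Drifts -/

/-- The update may be correlated with the load of the slot. Keeping the no-update indicator only on
the leading term `err ^ 3` avoids any expectation of a product of the two. -/
theorem err_next_pow_three_le {x : Outcome M N} (hx : x ∈ (outcome A S P z).support)
    (m : Fin M) (n : Fin N) :
    (x.next z).err m n ^ 3 ≤ {x : Outcome M N | x.2.2.2.1 m n = true}ᶜ.indicator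
        (fun _ => z.err m n ^ 3) x
      + (3 * z.err m n ^ 2 * x.load ^ 1 + 3 * z.err m n * x.load ^ 2 + x.load ^ 3) := by
  have h := P.err_next_le (mem_support_outcome A S P hx) m n
  have h0 := (x.next z).err_nonneg m n
  have h1 := z.err_nonneg m n
  have h2 := x.one_le_load
  by_cases hu : x.2.2.2.1 m n = true
  · rw [if_pos hu] at h
    rw [le_antisymm h h0, Set.indicator_of_notMem (by simpa using hu), zero_pow (by norm_num),
      zero_add]
    positivity
  · rw [if_neg hu] at h
    rw [Set.indicator_of_mem (by simpa using hu)]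
    calc _ ≤ (z.err m n + x.load) ^ 3 := pow_le_pow_left₀ h0 h 3
      _ = _ := by ring

theorem integrable_err_next_pow_three
    (hB : ∫⁻ x, ENNReal.ofReal (x.load ^ 4) ∂(outcome A S P z).toMeasure ≤ ENNReal.ofReal B)
    (m : Fin M) (n : Fin N) :
    Integrable (fun x => (x.next z).err m n ^ 3) (outcome A S P z).toMeasure := by
  refine integrable_of_abs_le (g := fun x => z.err m n ^ 3
    + (3 * z.err m n ^ 2 * x.load ^ 1 + 3 * z.err m n * x.load ^ 2 + x.load ^ 3)) ?_ ?_
  · exact (integrable_const _).add ((((integrable_load_pow hB (by norm_num)).const_mul _).add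
      ((integrable_load_pow hB (by norm_num)).const_mul _)).add
      (integrable_load_pow hB (by norm_num)))
  · filter_upwards [ae_mem_support _] with x hx
    have h0 := (x.next z).err_nonneg m n
    rw [abs_of_nonneg (pow_nonneg h0 3)]
    refine (err_next_pow_three_le hx m n).trans (add_le_add_left ?_ _)
    exact Set.indicator_le_self' (fun _ _ => pow_nonneg (z.err_nonneg m n) 3) x

theorem integral_err_next_pow_three_le (hB0 : 0 ≤ B)
    (hB : ∫⁻ x, ENNReal.ofReal (x.load ^ 4) ∂(outcome A S P z).toMeasure ≤ ENNReal.ofReal B)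
    {p : ℝ} (m : Fin M) (n : Fin N) (hp : ENNReal.ofReal p ≤ updateProb A S P z m n) :
    ∫ x, (x.next z).err m n ^ 3 ∂(outcome A S P z).toMeasure
      ≤ (1 - p) * z.err m n ^ 3 + (3 * z.err m n ^ 2 * B + 3 * z.err m n * B + B) := by
  have h1 := z.err_nonneg m n
  have hi1 := (integrable_load_pow hB (k := 1) (by norm_num)).const_mul (3 * z.err m n ^ 2)
  have hi2 := (integrable_load_pow hB (k := 2) (by norm_num)).const_mul (3 * z.err m n)
  have hi3 := integrable_load_pow hB (k := 3) (by norm_num)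
  have hms : MeasurableSet {x : Outcome M N | x.2.2.2.1 m n = true}ᶜ :=
    (Set.to_countable _).measurableSet
  have hi12 : Integrable (fun x : Outcome M N => 3 * z.err m n ^ 2 * x.load ^ 1
      + 3 * z.err m n * x.load ^ 2) (outcome A S P z).toMeasure := hi1.add hi2
  have hi123 : Integrable (fun x : Outcome M N => 3 * z.err m n ^ 2 * x.load ^ 1
      + 3 * z.err m n * x.load ^ 2 + x.load ^ 3) (outcome A S P z).toMeasure := hi12.add hi3
  have hi0 : Integrable ({x : Outcome M N | x.2.2.2.1 m n = true}ᶜ.indicator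
      (fun _ => z.err m n ^ 3)) (outcome A S P z).toMeasure :=
    (integrable_const _).indicator hms
  calc _ ≤ ∫ x, ({x : Outcome M N | x.2.2.2.1 m n = true}ᶜ.indicator
        (fun _ => z.err m n ^ 3) x
      + (3 * z.err m n ^ 2 * x.load ^ 1 + 3 * z.err m n * x.load ^ 2 + x.load ^ 3))
        ∂(outcome A S P z).toMeasure := by
        refine integral_mono_ae (integrable_err_next_pow_three hB m n)
          (hi0.add hi123) ?_
        filter_upwards [ae_mem_support _] with x hx
        exact err_next_pow_three_le hx m n
    _ ≤ _ := by
        rw [integral_add hi0 hi123, integral_add hi12 hi3,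
          integral_add hi1 hi2, integral_const_mul, integral_const_mul,
          integral_indicator_const _ hms]
        gcongr
        · rw [smul_eq_mul]
          gcongr
          rw [probReal_compl_eq_one_sub (Set.to_countable _).measurableSet]
          have : p ≤ (outcome A S P z).toMeasure.real {x | x.2.2.2.1 m n = true} := by
            rw [updateProb_eq] at hp
            exact (ENNReal.ofReal_le_iff_le_toReal (measure_ne_top _ _)).1 hp
          linarith
        · exact integral_load_pow_le hB0 hB (by norm_num)
        · exact integral_load_pow_le hB0 hB (by norm_num)
        · exact integral_load_pow_le hB0 hB (by norm_num)

variable [NeZero N] {κ : ℝ}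

theorem spread_next_le_mul_load_sq (hκ : κ = 0 ∨ κ = 1) (z : State M N) (x : Outcome M N) :
    (x.next z).spread κ ≤ (z.spread κ + 2 * N * √(z.spread κ) + N) * x.load ^ 2 := by
  have h1 := (abs_le.1 (x.abs_spread_next_sub_le hκ z)).2
  have h2 := x.one_le_load
  have h3 := z.spread_nonneg κ
  have h4 := Real.sqrt_nonneg (z.spread κ)
  have h5 : x.load ≤ x.load ^ 2 := by nlinarith
  have h6 : 1 ≤ x.load ^ 2 := by nlinarith
  have h7 : (0 : ℝ) ≤ 2 * N * √(z.spread κ) := by positivity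
  nlinarith [mul_le_mul_of_nonneg_left h5 h7, mul_le_mul_of_nonneg_left h6 h3]

theorem integrable_spread_next (hκ : κ = 0 ∨ κ = 1)
    (hB : ∫⁻ x, ENNReal.ofReal (x.load ^ 4) ∂(outcome A S P z).toMeasure ≤ ENNReal.ofReal B) :
    Integrable (fun x => (x.next z).spread κ) (outcome A S P z).toMeasure := by
  refine integrable_of_abs_le ((integrable_load_pow hB (k := 2) (by norm_num)).const_mul
    (z.spread κ + 2 * N * √(z.spread κ) + N)) (Eventually.of_forall fun x => ?_)
  rw [abs_of_nonneg (State.spread_nonneg _ _)]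
  exact spread_next_le_mul_load_sq hκ z x

theorem integrable_spread_next_sq (hκ : κ = 0 ∨ κ = 1)
    (hB : ∫⁻ x, ENNReal.ofReal (x.load ^ 4) ∂(outcome A S P z).toMeasure ≤ ENNReal.ofReal B) :
    Integrable (fun x => (x.next z).spread κ ^ 2) (outcome A S P z).toMeasure := by
  refine integrable_of_abs_le ((integrable_load_pow hB (k := 4) (by norm_num)).const_mul
    ((z.spread κ + 2 * N * √(z.spread κ) + N) ^ 2)) (Eventually.of_forall fun x => ?_)
  rw [abs_of_nonneg (sq_nonneg _)]
  calc _ ≤ ((z.spread κ + 2 * N * √(z.spread κ) + N) * x.load ^ 2) ^ 2 :=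
        pow_le_pow_left₀ (State.spread_nonneg _ _) (spread_next_le_mul_load_sq hκ z x) 2
    _ = _ := by ring

theorem integral_spread_next_le (hκ : κ = 0 ∨ κ = 1) (hB0 : 0 ≤ B)
    (hB : ∫⁻ x, ENNReal.ofReal (x.load ^ 4) ∂(outcome A S P z).toMeasure ≤ ENNReal.ofReal B) :
    ∫ x, (x.next z).spread κ ∂(outcome A S P z).toMeasure
      ≤ z.spread κ + 2 * ∑ n, deviation κ z.q n * netRate A S P z n + (2 + N) * B := by
  have hi : ∀ n, Integrable (fun x : Outcome M N => deviation κ z.q n *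
      ((arrivalTo x.1 x.2.1 n : ℝ) - x.2.2.1 n)) (outcome A S P z).toMeasure := fun n =>
    ((integrable_arrivalTo hB n).sub (integrable_service hB n)).const_mul _
  have hi1 : Integrable (fun x : Outcome M N => 2 * ∑ n, deviation κ z.q n *
      ((arrivalTo x.1 x.2.1 n : ℝ) - x.2.2.1 n)) (outcome A S P z).toMeasure :=
    (integrable_finsetSum Finset.univ fun n _ => hi n).const_mul 2
  have hi0 : Integrable (fun x : Outcome M N => z.spread κ + 2 * ∑ n, deviation κ z.q n *
      ((arrivalTo x.1 x.2.1 n : ℝ) - x.2.2.1 n)) (outcome A S P z).toMeasure :=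
    (integrable_const _).add hi1
  have hi2 := (integrable_load_pow hB (k := 2) (by norm_num)).const_mul (2 + N : ℝ)
  have hi3 : Integrable (fun x : Outcome M N => z.spread κ + 2 * ∑ n, deviation κ z.q n *
      ((arrivalTo x.1 x.2.1 n : ℝ) - x.2.2.1 n) + (2 + N) * x.load ^ 2)
      (outcome A S P z).toMeasure := hi0.add hi2
  calc ∫ x, (x.next z).spread κ ∂(outcome A S P z).toMeasure
      ≤ ∫ x : Outcome M N, (z.spread κ
        + 2 * ∑ n, deviation κ z.q n * ((arrivalTo x.1 x.2.1 n : ℝ) - x.2.2.1 n)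
        + (2 + N) * x.load ^ 2) ∂(outcome A S P z).toMeasure :=
        integral_mono (integrable_spread_next hκ hB) hi3 fun x => x.spread_next_le hκ z
    _ = z.spread κ + 2 * ∑ n, deviation κ z.q n * netRate A S P z n
        + (2 + N) * ∫ x, x.load ^ 2 ∂(outcome A S P z).toMeasure := by
        rw [integral_add hi0 hi2, integral_add (integrable_const _) hi1,
          integral_const_mul, integral_const_mul, integral_finsetSum _ fun n _ => hi n]
        simp_rw [integral_const_mul, integral_arrivalTo_sub_service hB]
        simp
    _ ≤ _ := by
        gcongr
        exact integral_load_pow_le hB0 hB (by norm_num)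

/-- With `W` for the spread, write `W'² = W² + 2W(W' - W) + (W' - W)²`. The middle term carries the
signed drift; the last one is of order `W` and needs the fourth moment of the load. -/
theorem integral_spread_next_sq_le (hκ : κ = 0 ∨ κ = 1) (hB0 : 0 ≤ B)
    (hB : ∫⁻ x, ENNReal.ofReal (x.load ^ 4) ∂(outcome A S P z).toMeasure ≤ ENNReal.ofReal B) :
    ∫ x, (x.next z).spread κ ^ 2 ∂(outcome A S P z).toMeasure
      ≤ z.spread κ ^ 2
        + 2 * z.spread κ * (2 * ∑ n, deviation κ z.q n * netRate A S P z n + (2 + N) * B)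
        + 8 * N ^ 2 * z.spread κ * B + 2 * N ^ 2 * B := by
  have h0 := z.spread_nonneg κ
  have hpt : ∀ x : Outcome M N, (x.next z).spread κ ^ 2
      ≤ z.spread κ ^ 2 + 2 * z.spread κ * ((x.next z).spread κ - z.spread κ)
        + 8 * N ^ 2 * z.spread κ * x.load ^ 2 + 2 * N ^ 2 * x.load ^ 4 := fun x => by
    have h1 := x.abs_spread_next_sub_le hκ z
    have h2 : ((x.next z).spread κ - z.spread κ) ^ 2
        ≤ (2 * N * √(z.spread κ) * x.load + N * x.load ^ 2) ^ 2 :=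
      sq_le_sq' (abs_le.1 h1).1 (abs_le.1 h1).2
    have h3 : (2 * N * √(z.spread κ) * x.load + N * x.load ^ 2) ^ 2
        ≤ 2 * (2 * N * √(z.spread κ) * x.load) ^ 2 + 2 * (N * x.load ^ 2) ^ 2 := by
      nlinarith [sq_nonneg (2 * N * √(z.spread κ) * x.load - N * x.load ^ 2)]
    have h4 : 2 * (2 * N * √(z.spread κ) * x.load) ^ 2 + 2 * (N * x.load ^ 2) ^ 2
        = 8 * N ^ 2 * z.spread κ * x.load ^ 2 + 2 * N ^ 2 * x.load ^ 4 := by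
      simp only [mul_pow, Real.sq_sqrt h0]
      ring
    nlinarith
  have hi1 : Integrable (fun x : Outcome M N => 2 * z.spread κ *
      ((x.next z).spread κ - z.spread κ)) (outcome A S P z).toMeasure :=
    ((integrable_spread_next hκ hB).sub (integrable_const (z.spread κ))).const_mul _
  have hi2 := (integrable_load_pow hB (k := 2) (by norm_num)).const_mul (8 * N ^ 2 * z.spread κ)
  have hi3 := (integrable_load_pow hB (k := 4) (by norm_num)).const_mul (2 * (N : ℝ) ^ 2)
  have hi4 : Integrable (fun x : Outcome M N => z.spread κ ^ 2 + 2 * z.spread κ *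
      ((x.next z).spread κ - z.spread κ)) (outcome A S P z).toMeasure :=
    (integrable_const _).add hi1
  have hi5 : Integrable (fun x : Outcome M N => z.spread κ ^ 2 + 2 * z.spread κ *
      ((x.next z).spread κ - z.spread κ) + 8 * N ^ 2 * z.spread κ * x.load ^ 2)
      (outcome A S P z).toMeasure := hi4.add hi2
  have hi6 : Integrable (fun x : Outcome M N => z.spread κ ^ 2 + 2 * z.spread κ *
      ((x.next z).spread κ - z.spread κ) + 8 * N ^ 2 * z.spread κ * x.load ^ 2
      + 2 * N ^ 2 * x.load ^ 4) (outcome A S P z).toMeasure := hi5.add hi3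
  calc ∫ x, (x.next z).spread κ ^ 2 ∂(outcome A S P z).toMeasure
      ≤ ∫ x : Outcome M N, (z.spread κ ^ 2 + 2 * z.spread κ * ((x.next z).spread κ - z.spread κ)
        + 8 * N ^ 2 * z.spread κ * x.load ^ 2 + 2 * N ^ 2 * x.load ^ 4)
        ∂(outcome A S P z).toMeasure :=
        integral_mono (integrable_spread_next_sq hκ hB) hi6 hpt
    _ = z.spread κ ^ 2
        + 2 * z.spread κ * (∫ x, (x.next z).spread κ ∂(outcome A S P z).toMeasure - z.spread κ)
        + 8 * N ^ 2 * z.spread κ * ∫ x, x.load ^ 2 ∂(outcome A S P z).toMeasure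
        + 2 * N ^ 2 * ∫ x, x.load ^ 4 ∂(outcome A S P z).toMeasure := by
        rw [integral_add hi5 hi3, integral_add hi4 hi2,
          integral_add (integrable_const _) hi1, integral_const_mul, integral_const_mul,
          integral_const_mul, integral_sub (integrable_spread_next hκ hB) (integrable_const _)]
        simp
    _ ≤ _ := by
        gcongr
        · linarith [integral_spread_next_le hκ hB0 hB]
        · exact integral_load_pow_le hB0 hB (by norm_num)
        · exact integral_load_pow_le hB0 hB (by norm_num)

end Moments

/-! ### The effect of tilted dispatching -/

section Tilt

variable {M N : ℕ} (A : PMF (Fin M → ℕ)) (S : Fin N → PMF ℕ) (P : Policy M N)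

/-- Probability that dispatcher `m` chooses server `n`, minus the share of that server in the total
service rate. -/
def bias (z : State M N) (m : Fin M) (n : Fin N) : ℝ :=
  (P.dispatch m (z.est m) n).toReal - mean (S n) / ∑ i, mean (S i)

theorem sum_toReal_pmf {α : Type*} [Fintype α] (q : PMF α) : ∑ a, (q a).toReal = 1 := by
  rw [← ENNReal.toReal_sum fun a _ => q.apply_ne_top a, ← tsum_fintype (L := .unconditional _),
    q.tsum_coe, ENNReal.toReal_one]

theorem toReal_pmf_le_one {α : Type*} (q : PMF α) (a : α) : (q a).toReal ≤ 1 := by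
  simpa using ENNReal.toReal_mono ENNReal.one_ne_top (q.coe_le_one a)

variable {S}

theorem sum_mean_pos [NeZero N] (hμ : ∀ n, 0 < mean (S n)) : 0 < ∑ n, mean (S n) :=
  Finset.sum_pos (fun n _ => hμ n) Finset.univ_nonempty

theorem sum_bias [NeZero N] (hμ : ∀ n, 0 < mean (S n)) (z : State M N) (m : Fin M) : ∑ n, bias S P z m n = 0 := by
  simp only [bias, Finset.sum_sub_distrib]
  rw [sum_toReal_pmf, ← Finset.sum_div, div_self (sum_mean_pos hμ).ne', sub_self]

theorem abs_bias_le [NeZero N] (hμ : ∀ n, 0 < mean (S n)) (z : State M N) (m : Fin M) (n : Fin N) :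
    |bias S P z m n| ≤ 1 := by
  have h1 := toReal_pmf_le_one (P.dispatch m (z.est m)) n
  have h2 : 0 ≤ (P.dispatch m (z.est m) n).toReal := ENNReal.toReal_nonneg
  have h3 : 0 ≤ mean (S n) / ∑ i, mean (S i) := div_nonneg (hμ n).le (sum_mean_pos hμ).le
  have h4 : mean (S n) / ∑ i, mean (S i) ≤ 1 := by
    rw [div_le_one (sum_mean_pos hμ)]
    exact Finset.single_le_sum (f := fun i => mean (S i)) (fun i _ => (hμ i).le)
      (Finset.mem_univ n)
  rw [bias, abs_le]
  constructor <;> linarith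

variable {A P}

/-- Tilted dispatching based on estimates pushes the queue lengths together, up to the estimation
errors. -/
theorem sum_q_mul_bias_le [NeZero N] (hμ : ∀ n, 0 < mean (S n)) {δ : ℝ} (hδ : 0 < δ) {m : Fin M}
    (htilt : IsDeltaTilted A S P δ m) {z : State M N} (hz : z ∈ stateSpace A S P) (a b : Fin N) :
    ∑ n, z.q n * bias S P z m n ≤ 3 * ∑ n, z.err m n - δ * (z.q a - z.q b) := by
  obtain ⟨k, hk2, hkN, hk⟩ := htilt
  obtain ⟨σ, hmono, hσ⟩ := hk z hz
  have hpref : ∀ i, preference S P m (z.est m) σ i = bias S P z m (σ i) := fun i => rfl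
  simp only [hpref] at hσ
  -- The bias at the first position is at least `δ` and at most one.
  have hδ1 : δ ≤ 1 :=
    ((hσ ⟨0, by omega⟩).2.2.1 (by simp)).trans ((le_abs_self _).trans (abs_bias_le P hμ _ _ _))
  have hest : ∑ n, (z.est m n : ℝ) * bias S P z m n ≤ -δ * ((z.est m a : ℝ) - z.est m b) := by
    have := sum_mul_le_of_tilted (g := fun i => (z.est m (σ i) : ℝ))
      (D := fun i => bias S P z m (σ i)) (fun i j h => Nat.cast_le.2 (hmono h)) hk2 hkN
      (by rw [Equiv.sum_comp σ (fun n => bias S P z m n), sum_bias P hμ]) hσ (σ.symm a) (σ.symm b)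
      hδ.le
    rwa [Equiv.sum_comp σ (fun n => (z.est m n : ℝ) * bias S P z m n), Equiv.apply_symm_apply,
      Equiv.apply_symm_apply] at this
  have hdiff : ∑ n, (z.q n - z.est m n) * bias S P z m n ≤ ∑ n, z.err m n := by
    refine Finset.sum_le_sum fun n _ => (le_abs_self _).trans ?_
    rw [abs_mul]
    exact mul_le_of_le_one_right (abs_nonneg _) (abs_bias_le P hμ _ _ _)
  have hsplit : ∑ n, z.q n * bias S P z m n = ∑ n, (z.q n - z.est m n) * bias S P z m n
      + ∑ n, (z.est m n : ℝ) * bias S P z m n := by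
    rw [← Finset.sum_add_distrib]
    exact Finset.sum_congr rfl fun n _ => by ring
  have herr : ∀ n, z.err m n ≤ ∑ n, z.err m n := fun n =>
    Finset.single_le_sum (f := fun n => z.err m n) (fun n _ => z.err_nonneg m n)
      (Finset.mem_univ n)
  -- Replacing the estimated difference of `a` and `b` by the true one costs two further error sums.
  -- Together with `hdiff` this makes the factor 3, as `δ ≤ 1`.
  have ha : z.q a - z.est m a ≤ ∑ n, z.err m n := (le_abs_self _).trans (herr a)
  have hb : -(z.q b - z.est m b) ≤ ∑ n, z.err m n := (neg_le_abs _).trans (herr b)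
  have h0 : 0 ≤ ∑ n, z.err m n := Finset.sum_nonneg fun n _ => z.err_nonneg m n
  rw [hsplit]
  nlinarith [mul_le_mul_of_nonneg_left ha hδ.le, mul_le_mul_of_nonneg_left hb hδ.le,
    mul_le_mul_of_nonneg_right hδ1 h0]

/-- Decomposition of the drift into the parts due to the preferences and to the spare capacity. -/
theorem sum_deviation_mul_netRate [NeZero N] (hμ : ∀ n, 0 < mean (S n)) {ε : ℝ}
    (hε : ∑ m, arrivalMean A m = (∑ n, mean (S n)) - ε) (κ : ℝ) (z : State M N) :
    ∑ n, deviation κ z.q n * netRate A S P z n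
      = ∑ m, arrivalMean A m * ∑ n, z.q n * bias S P z m n
        - ε / (∑ n, mean (S n)) * ∑ n, deviation κ z.q n * mean (S n) := by
  have hpos := sum_mean_pos hμ
  have h1 : ∀ n, netRate A S P z n = ∑ m, arrivalMean A m * bias S P z m n
      - ε / (∑ n, mean (S n)) * mean (S n) := fun n => by
    simp only [netRate, bias, mul_sub, Finset.sum_sub_distrib]
    rw [← Finset.sum_mul, hε]
    field_simp
    ring
  -- The biases sum to zero, so subtracting the mean of the queues has no effect on this term.
  have h2 : ∀ m, ∑ n, deviation κ z.q n * bias S P z m n = ∑ n, z.q n * bias S P z m n := by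
    intro m
    simp only [deviation, sub_mul, Finset.sum_sub_distrib]
    rw [← Finset.mul_sum, sum_bias P hμ, mul_zero, sub_zero]
  simp_rw [← h2, h1, mul_sub, Finset.sum_sub_distrib, Finset.mul_sum]
  congr 1
  · rw [Finset.sum_comm]
    exact Finset.sum_congr rfl fun m _ => Finset.sum_congr rfl fun n _ => by ring
  · exact Finset.sum_congr rfl fun n _ => by ring

theorem sum_arrivalMean_mul_err_le {ε : ℝ} (hε0 : 0 < ε)
    (hε : ∑ m, arrivalMean A m = (∑ n, mean (S n)) - ε) (z : State M N) :
    ∑ m, arrivalMean A m * ∑ n, z.err m n ≤ (∑ n, mean (S n)) * z.errSum := by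
  rw [State.errSum, Finset.mul_sum]
  refine Finset.sum_le_sum fun m _ => mul_le_mul_of_nonneg_right ?_
    (Finset.sum_nonneg fun n _ => z.err_nonneg m n)
  have := Finset.single_le_sum (f := fun m => arrivalMean A m)
    (fun m _ => arrivalMean_nonneg A m) (Finset.mem_univ m)
  linarith

/-- Drift of the squared queue lengths. -/
theorem sum_deviation_zero_mul_netRate_le [NeZero N] (hμ : ∀ n, 0 < mean (S n))
    {ε δ μ₀ : ℝ} (hε0 : 0 < ε) (hδ : 0 < δ)
    (hμ₀ : ∀ n, μ₀ ≤ mean (S n)) (hμ₀' : 0 ≤ μ₀)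
    (hε : ∑ m, arrivalMean A m = (∑ n, mean (S n)) - ε)
    (htilt : ∀ m, IsDeltaTilted A S P δ m) {z : State M N} (hz : z ∈ stateSpace A S P) :
    ∑ n, deviation 0 z.q n * netRate A S P z n
      ≤ -(ε / (∑ n, mean (S n)) * μ₀) * √(z.spread 0) + 3 * (∑ n, mean (S n)) * z.errSum := by
  have hpos := sum_mean_pos hμ
  rw [sum_deviation_mul_netRate hμ hε]
  have h1 : ∑ m, arrivalMean A m * ∑ n, z.q n * bias S P z m n
      ≤ 3 * ((∑ n, mean (S n)) * z.errSum) := by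
    refine le_trans ?_ (mul_le_mul_of_nonneg_left (sum_arrivalMean_mul_err_le hε0 hε z)
      (by norm_num))
    rw [Finset.mul_sum]
    refine Finset.sum_le_sum fun m _ => ?_
    -- With `a = b` the gain from tilting is dropped: here the negative drift comes from the spare
    -- capacity alone.
    have := sum_q_mul_bias_le hμ hδ (htilt m) hz 0 0
    rw [sub_self, mul_zero, sub_zero] at this
    linarith [mul_le_mul_of_nonneg_left this (arrivalMean_nonneg A m)]
  have h2 : μ₀ * √(z.spread 0) ≤ ∑ n, deviation 0 z.q n * mean (S n) := by
    calc μ₀ * √(z.spread 0) ≤ μ₀ * ∑ n, z.q n :=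
          mul_le_mul_of_nonneg_left (sqrt_sum_sq_deviation_zero_le z.q z.q_nonneg) hμ₀'
      _ ≤ _ := by
          rw [Finset.mul_sum]
          refine Finset.sum_le_sum fun n _ => ?_
          simp only [deviation, zero_mul, sub_zero]
          rw [mul_comm]
          exact mul_le_mul_of_nonneg_left (hμ₀ n) (z.q_nonneg n)
  have h3 := mul_le_mul_of_nonneg_left h2 (div_pos hε0 hpos).le
  linarith

/-- Drift of the squared deviation of the queue lengths from their mean. -/
theorem sum_deviation_one_mul_netRate_le [NeZero N] (hμ : ∀ n, 0 < mean (S n))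
    {ε δ : ℝ} (hε0 : 0 < ε) (hδ : 0 < δ)
    (hε : ∑ m, arrivalMean A m = (∑ n, mean (S n)) - ε)
    (hε1 : ε ≤ (∑ n, mean (S n)) / 2) (hε2 : ε ≤ δ * (∑ n, mean (S n)) / (4 * N))
    (htilt : ∀ m, IsDeltaTilted A S P δ m) {z : State M N} (hz : z ∈ stateSpace A S P) :
    ∑ n, deviation 1 z.q n * netRate A S P z n
      ≤ -(δ * (∑ n, mean (S n)) / (4 * N)) * √(z.spread 1)
        + 3 * (∑ n, mean (S n)) * z.errSum := by
  have hpos := sum_mean_pos hμ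
  have hN : (0 : ℝ) < N := Nat.cast_pos.2 (NeZero.pos N)
  set R := √(z.spread 1) with hR
  have hR0 : 0 ≤ R := Real.sqrt_nonneg _
  obtain ⟨a, b, hab⟩ := sqrt_sum_sq_deviation_one_le z.q
  have hab' : R / N ≤ z.q a - z.q b := by
    rw [div_le_iff₀ hN, mul_comm]
    exact hab
  rw [sum_deviation_mul_netRate hμ hε]
  have h1 : ∑ m, arrivalMean A m * ∑ n, z.q n * bias S P z m n
      ≤ 3 * ((∑ n, mean (S n)) * z.errSum) - ((∑ n, mean (S n)) - ε) * (δ * (R / N)) := by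
    have h2 : ∀ m, arrivalMean A m * ∑ n, z.q n * bias S P z m n
        ≤ 3 * (arrivalMean A m * ∑ n, z.err m n) - arrivalMean A m * (δ * (R / N)) := fun m => by
      have h3 := sum_q_mul_bias_le hμ hδ (htilt m) hz a b
      have h4 : ∑ n, z.q n * bias S P z m n ≤ 3 * ∑ n, z.err m n - δ * (R / N) := by
        linarith [mul_le_mul_of_nonneg_left hab' hδ.le]
      linarith [mul_le_mul_of_nonneg_left h4 (arrivalMean_nonneg A m)]
    refine (Finset.sum_le_sum fun m _ => h2 m).trans ?_
    rw [Finset.sum_sub_distrib, ← Finset.mul_sum, ← Finset.sum_mul, hε]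
    linarith [sum_arrivalMean_mul_err_le hε0 hε z]
  have h2 : -(∑ n, deviation 1 z.q n * mean (S n)) ≤ R * ∑ n, mean (S n) := by
    rw [← Finset.sum_neg_distrib, Finset.mul_sum]
    refine Finset.sum_le_sum fun n _ => ?_
    rw [← neg_mul]
    exact mul_le_mul_of_nonneg_right ((neg_le_abs _).trans (abs_deviation_le_sqrt 1 z.q n))
      (hμ n).le
  have h3 : -(ε / (∑ n, mean (S n)) * ∑ n, deviation 1 z.q n * mean (S n)) ≤ ε * R := by
    have := mul_le_mul_of_nonneg_left h2 (div_pos hε0 hpos).le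
    have h4 : ε / (∑ n, mean (S n)) * (R * ∑ n, mean (S n)) = ε * R := by
      field_simp
    linarith
  -- As `ε` is at most half the total service rate, tilting yields twice the rate `δ * (∑ n, mean (S
  -- n)) / (4 * N)` in the claim. One half pays for the adverse term `ε * R` from the spare
  -- capacity.
  have h4 : (∑ n, mean (S n)) / 2 * (δ * (R / N)) ≤ ((∑ n, mean (S n)) - ε) * (δ * (R / N)) :=
    mul_le_mul_of_nonneg_right (by linarith) (by positivity)
  have h5 : (∑ n, mean (S n)) / 2 * (δ * (R / N)) = 2 * (δ * (∑ n, mean (S n)) / (4 * N) * R) := by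
    field_simp
    ring
  have h6 : ε * R ≤ δ * (∑ n, mean (S n)) / (4 * N) * R := mul_le_mul_of_nonneg_right hε2 hR0
  linarith

end Tilt

/-! ### The Lyapunov function -/

/-- Young's inequality with exponents `3/2` and `3`, obtained by comparing `C * y` with `η * x`. It
is also used with `y = 1`, to absorb squares into cubes plus a constant. -/
theorem mul_sq_mul_le_cube {η : ℝ} (hη : 0 < η) {C : ℝ} (hC : 0 ≤ C) {x y : ℝ} (hx : 0 ≤ x)
    (hy : 0 ≤ y) : C * x ^ 2 * y ≤ η * x ^ 3 + C * (C / η) ^ 2 * y ^ 3 := by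
  rcases le_total (C * y) (η * x) with h | h
  · have h1 : C * x ^ 2 * y ≤ η * x ^ 3 := by nlinarith [mul_le_mul_of_nonneg_left h (sq_nonneg x)]
    have h2 : 0 ≤ C * (C / η) ^ 2 * y ^ 3 := by positivity
    linarith
  · have h1 : x ≤ C / η * y := by
      rw [div_mul_eq_mul_div, le_div_iff₀ hη]
      linarith
    have h2 : x ^ 2 ≤ (C / η * y) ^ 2 := pow_le_pow_left₀ hx h1 2
    have h3 : 0 ≤ η * x ^ 3 := by positivity
    have h4 : C * x ^ 2 * y ≤ C * (C / η * y) ^ 2 * y := by gcongr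
    calc C * x ^ 2 * y ≤ C * (C / η * y) ^ 2 * y := h4
      _ = C * (C / η) ^ 2 * y ^ 3 := by ring
      _ ≤ _ := by linarith

/-- Choice of the constants in the Lyapunov function. -/
theorem exists_lyapunov_constants {ι : Type*} [Fintype ι] {c C a d B p : ℝ} (hc : 0 < c)
    (hC : 0 ≤ C) (ha : 0 ≤ a) (hd : 0 ≤ d) (hB : 0 ≤ B) (hp : 0 < p) :
    ∃ K b : ℝ, 0 ≤ K ∧ 0 ≤ b ∧ ∀ (R : ℝ) (e : ι → ℝ), 0 ≤ R → (∀ i, 0 ≤ e i) →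
      R ^ 4 + 2 * R ^ 2 * (2 * (-c * R + C * ∑ i, e i)) + a * R ^ 2 + d
        + K * ∑ i, ((1 - p) * e i ^ 3 + (3 * e i ^ 2 * B + 3 * e i * B + B))
        + (c * R ^ 3 + ∑ i, e i ^ 3) ≤ R ^ 4 + K * ∑ i, e i ^ 3 + b := by
  -- One share of `R ^ 3` for each error, so that all cross terms together use at most `c * R ^ 3`.
  set η := c / (Fintype.card ι + 1) with hη_def
  have hη : 0 < η := by positivity
  have hηc : Fintype.card ι * η ≤ c := by
    rw [hη_def, mul_div_assoc', div_le_iff₀ (by positivity)]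
    linarith
  set G := 4 * C * (4 * C / η) ^ 2 with hG
  have hG0 : 0 ≤ G := by positivity
  -- The contraction of the errors then yields `2 * (G + 1)` times their cubes: `G` for the cross
  -- terms, 1 for the decrease claimed, and the other `G + 1` for the lower powers of the errors.
  set K := 2 * (G + 1) / p with hK
  have hK0 : 0 ≤ K := by positivity
  have hKp : K * p = 2 * (G + 1) := by rw [hK]; field_simp
  set G₂ := a * (a / c) ^ 2 with hG₂
  set G₃ := 6 * K * B * (6 * K * B / (G + 1)) ^ 2 with hG₃
  have hG₂0 : 0 ≤ G₂ := by positivity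
  have hG₃0 : 0 ≤ G₃ := by positivity
  refine ⟨K, d + G₂ + Fintype.card ι * (G₃ + 4 * K * B), hK0, by positivity, fun R e hR he => ?_⟩
  have h1 : 2 * R ^ 2 * (2 * (C * ∑ i, e i)) ≤ c * R ^ 3 + G * ∑ i, e i ^ 3 := by
    calc 2 * R ^ 2 * (2 * (C * ∑ i, e i)) = ∑ i, 4 * C * R ^ 2 * e i := by
          rw [← Finset.mul_sum]; ring
      _ ≤ ∑ i, (η * R ^ 3 + G * e i ^ 3) :=
          Finset.sum_le_sum fun i _ => mul_sq_mul_le_cube hη (by positivity) hR (he i)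
      _ = Fintype.card ι * η * R ^ 3 + G * ∑ i, e i ^ 3 := by
          rw [Finset.sum_add_distrib, Finset.sum_const, ← Finset.mul_sum, Finset.card_univ,
            nsmul_eq_mul]
          ring
      _ ≤ _ := by gcongr
  have h2 : a * R ^ 2 ≤ c * R ^ 3 + G₂ := by
    simpa using mul_sq_mul_le_cube hc ha hR zero_le_one
  have h3 : K * ∑ i, ((1 - p) * e i ^ 3 + (3 * e i ^ 2 * B + 3 * e i * B + B))
      ≤ K * ∑ i, e i ^ 3 - (G + 1) * ∑ i, e i ^ 3
        + Fintype.card ι * (G₃ + 4 * K * B) := by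
    have hcard : Fintype.card ι * (G₃ + 4 * K * B) = ∑ _i : ι, (G₃ + 4 * K * B) := by
      rw [Finset.sum_const, Finset.card_univ, nsmul_eq_mul]
    rw [Finset.mul_sum, Finset.mul_sum, Finset.mul_sum, hcard, ← Finset.sum_sub_distrib,
      ← Finset.sum_add_distrib]
    refine Finset.sum_le_sum fun i _ => ?_
    have h4 : 6 * K * B * e i ^ 2 ≤ (G + 1) * e i ^ 3 + G₃ := by
      simpa using mul_sq_mul_le_cube (by positivity : 0 < G + 1)
        (by positivity : 0 ≤ 6 * K * B) (he i) zero_le_one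
    have h5 : e i ≤ e i ^ 2 + 1 := by nlinarith [sq_nonneg (e i - 1), he i]
    have h6 : 3 * K * B * e i ≤ 3 * K * B * (e i ^ 2 + 1) :=
      mul_le_mul_of_nonneg_left h5 (by positivity)
    have h7 : K * p * e i ^ 3 = 2 * (G + 1) * e i ^ 3 := by rw [hKp]
    nlinarith
  -- Of the available `-4 * c * R ^ 3`, the cross terms, the term `a * R ^ 2` and the claimed
  -- decrease take one unit each; the fourth is discarded.
  have h8 : 0 ≤ c * R ^ 3 := by positivity
  nlinarith

section Lyapunov

variable {M N : ℕ}

/-- The Lyapunov function. -/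
def State.lyapunov (κ K : ℝ) (z : State M N) : ℝ :=
  z.spread κ ^ 2 + K * ∑ i : Fin M × Fin N, z.err i.1 i.2 ^ 3

/-- The guaranteed decrease of the Lyapunov function, up to constants. -/
def State.decrease (κ c : ℝ) (z : State M N) : ℝ :=
  c * √(z.spread κ) ^ 3 + ∑ i : Fin M × Fin N, z.err i.1 i.2 ^ 3

theorem State.sum_err_cube_nonneg (z : State M N) :
    0 ≤ ∑ i : Fin M × Fin N, z.err i.1 i.2 ^ 3 :=
  Finset.sum_nonneg fun _ _ => pow_nonneg (z.err_nonneg _ _) 3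

theorem State.lyapunov_nonneg {κ K : ℝ} (hK : 0 ≤ K) (z : State M N) : 0 ≤ z.lyapunov κ K :=
  add_nonneg (sq_nonneg _) (mul_nonneg hK z.sum_err_cube_nonneg)

theorem State.decrease_nonneg {κ c : ℝ} (hc : 0 ≤ c) (z : State M N) : 0 ≤ z.decrease κ c :=
  add_nonneg (mul_nonneg hc (pow_nonneg (Real.sqrt_nonneg _) 3)) z.sum_err_cube_nonneg

variable (M N) in
/-- Drift condition for the Lyapunov function, with constants that depend on the system only through
bounds on its parameters. -/
theorem exists_lyapunov_drift [NeZero N] {κ c C B p : ℝ} (hκ : κ = 0 ∨ κ = 1) (hc : 0 < c)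
    (hC : 0 ≤ C) (hB0 : 0 ≤ B) (hp : 0 < p) :
    ∃ K b : ℝ, 0 ≤ K ∧ 0 ≤ b ∧ ∀ (A : PMF (Fin M → ℕ)) (S : Fin N → PMF ℕ) (P : Policy M N)
      (z : State M N),
      ∫⁻ x, ENNReal.ofReal (x.load ^ 4) ∂(outcome A S P z).toMeasure ≤ ENNReal.ofReal B →
      (∀ m n, ENNReal.ofReal p ≤ updateProb A S P z m n) →
      ∑ n, deviation κ z.q n * netRate A S P z n ≤ -c * √(z.spread κ) + C * z.errSum →
      ∑' y, step A S P z y * ENNReal.ofReal (y.lyapunov κ K) + ENNReal.ofReal (z.decrease κ c)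
        ≤ ENNReal.ofReal (z.lyapunov κ K) + ENNReal.ofReal b := by
  -- `a` and `d` collect the coefficients of `spread` and of its zeroth power in
  -- `integral_spread_next_sq_le`, apart from the drift term.
  obtain ⟨K, b, hK, hb, h⟩ := exists_lyapunov_constants (ι := Fin M × Fin N)
    (a := 2 * (2 + N) * B + 8 * N ^ 2 * B) (d := 2 * N ^ 2 * B) hc hC (by positivity)
    (by positivity) hB0 hp
  refine ⟨K, b, hK, hb, fun A S P z hB hupd hrate => ?_⟩
  have hi1 := integrable_spread_next_sq hκ hB
  have hi2 : Integrable (fun x : Outcome M N => ∑ i : Fin M × Fin N, (x.next z).err i.1 i.2 ^ 3)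
      (outcome A S P z).toMeasure :=
    integrable_finsetSum _ fun i _ => integrable_err_next_pow_three hB i.1 i.2
  have hi : Integrable (fun x : Outcome M N => (x.next z).lyapunov κ K)
      (outcome A S P z).toMeasure := hi1.add (hi2.const_mul K)
  have hstep : ∑' y, step A S P z y * ENNReal.ofReal (y.lyapunov κ K)
      = ENNReal.ofReal (∫ x, (x.next z).lyapunov κ K ∂(outcome A S P z).toMeasure) := by
    rw [← lintegral_toMeasure_eq_tsum, step_eq_map_outcome, lintegral_toMeasure_map,
      ofReal_integral_eq_lintegral_ofReal hi
        (Eventually.of_forall fun x => State.lyapunov_nonneg hK _)]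
  rw [hstep, ← ENNReal.ofReal_add (integral_nonneg fun x => State.lyapunov_nonneg hK _)
    (State.decrease_nonneg hc.le z), ← ENNReal.ofReal_add (State.lyapunov_nonneg hK z) hb]
  refine ENNReal.ofReal_le_ofReal ?_
  have hexpand : ∫ x, (x.next z).lyapunov κ K ∂(outcome A S P z).toMeasure
      = ∫ x, (x.next z).spread κ ^ 2 ∂(outcome A S P z).toMeasure
        + K * ∑ i : Fin M × Fin N,
          ∫ x, (x.next z).err i.1 i.2 ^ 3 ∂(outcome A S P z).toMeasure := by
    simp only [State.lyapunov]
    rw [integral_add hi1 (hi2.const_mul K), integral_const_mul,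
      integral_finsetSum _ fun i _ => integrable_err_next_pow_three hB i.1 i.2]
  have hR := Real.sqrt_nonneg (z.spread κ)
  have hR2 : √(z.spread κ) ^ 2 = z.spread κ := Real.sq_sqrt (z.spread_nonneg κ)
  have hR4 : √(z.spread κ) ^ 4 = z.spread κ ^ 2 := by
    calc √(z.spread κ) ^ 4 = (√(z.spread κ) ^ 2) ^ 2 := by ring
      _ = _ := by rw [hR2]
  have h1 := integral_spread_next_sq_le hκ hB0 hB
  have h2 : K * ∑ i : Fin M × Fin N,
        ∫ x, (x.next z).err i.1 i.2 ^ 3 ∂(outcome A S P z).toMeasure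
      ≤ K * ∑ i : Fin M × Fin N, ((1 - p) * z.err i.1 i.2 ^ 3
        + (3 * z.err i.1 i.2 ^ 2 * B + 3 * z.err i.1 i.2 * B + B)) :=
    mul_le_mul_of_nonneg_left (Finset.sum_le_sum fun i _ =>
      integral_err_next_pow_three_le hB0 hB i.1 i.2 (hupd i.1 i.2)) hK
  have h3 := h (√(z.spread κ)) (fun i => z.err i.1 i.2) hR fun i => z.err_nonneg _ _
  have h4 : ∑ i : Fin M × Fin N, z.err i.1 i.2 = z.errSum := by
    rw [State.errSum, Fintype.sum_prod_type]
  have h5 := mul_le_mul_of_nonneg_left hrate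
    (by linarith [z.spread_nonneg κ] : 0 ≤ 4 * z.spread κ)
  simp only [h4, hR2, hR4] at h3
  rw [hexpand, State.decrease, State.lyapunov]
  linarith

end Lyapunov

/-! ### Net arrivals of a slot -/

section Net

variable {M N : ℕ} {A : PMF (Fin M → ℕ)} {S : Fin N → PMF ℕ} {P : Policy M N} {B : ℝ}

/-- Total arrivals minus total offered services. -/
def netArrivals (y : (Fin M → ℕ) × (Fin N → ℕ)) : ℝ := ∑ m, (y.1 m : ℝ) - ∑ n, (y.2 n : ℝ)

theorem Outcome.sum_arrivals_nonneg (x : Outcome M N) : 0 ≤ ∑ m, (x.1 m : ℝ) :=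
  Finset.sum_nonneg fun _ _ => Nat.cast_nonneg _

theorem Outcome.sum_services_nonneg (x : Outcome M N) : 0 ≤ ∑ n, (x.2.2.1 n : ℝ) :=
  Finset.sum_nonneg fun _ _ => Nat.cast_nonneg _

theorem Outcome.sum_arrivals_le_load (x : Outcome M N) : ∑ m, (x.1 m : ℝ) ≤ x.load := by
  rw [Outcome.load]
  linarith [x.sum_services_nonneg]

theorem Outcome.sum_services_le_load (x : Outcome M N) : ∑ n, (x.2.2.1 n : ℝ) ≤ x.load := by
  rw [Outcome.load]
  linarith [x.sum_arrivals_nonneg]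

/-- The state `z` is auxiliary: the arrivals have law `A` in every state, so a load bound in one
state suffices. -/
theorem integrable_sum_arrivals_pow {z : State M N}
    (hB : ∫⁻ x, ENNReal.ofReal (x.load ^ 4) ∂(outcome A S P z).toMeasure ≤ ENNReal.ofReal B)
    {k : ℕ} (hk : k ≤ 4) : Integrable (fun a => (∑ m, (a m : ℝ)) ^ k) A.toMeasure := by
  rw [← map_outcome_arrivals A S P z, integrable_toMeasure_map_iff]
  refine integrable_of_abs_le (integrable_load_pow hB hk) (Eventually.of_forall fun x => ?_)
  rw [abs_of_nonneg (pow_nonneg x.sum_arrivals_nonneg k)]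
  exact pow_le_pow_left₀ x.sum_arrivals_nonneg x.sum_arrivals_le_load k

theorem integrable_service_pow {z : State M N}
    (hB : ∫⁻ x, ENNReal.ofReal (x.load ^ 4) ∂(outcome A S P z).toMeasure ≤ ENNReal.ofReal B)
    {k : ℕ} (hk : k ≤ 4) (n : Fin N) :
    Integrable (fun s : ℕ => (s : ℝ) ^ k) (S n).toMeasure := by
  rw [← map_outcome_service A S P z n, integrable_toMeasure_map_iff]
  refine integrable_of_abs_le (integrable_load_pow hB hk) (Eventually.of_forall fun x => ?_)
  rw [abs_of_nonneg (by positivity)]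
  exact pow_le_pow_left₀ (Nat.cast_nonneg _)
    ((x.service_le_sum n).trans x.sum_services_le_load) k

theorem sum_arrivalMean {z : State M N}
    (hB : ∫⁻ x, ENNReal.ofReal (x.load ^ 4) ∂(outcome A S P z).toMeasure ≤ ENNReal.ofReal B) :
    ∑ m, arrivalMean A m = mean (totalArrival A) := by
  rw [mean_totalArrival, integral_finsetSum]
  · rfl
  · intro m _
    have h := integrable_sum_arrivals_pow hB (k := 1) (by norm_num)
    refine integrable_of_abs_le h (Eventually.of_forall fun a => ?_)
    rw [abs_of_nonneg (Nat.cast_nonneg _), pow_one]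
    exact Finset.single_le_sum (f := fun m => (a m : ℝ)) (fun _ _ => Nat.cast_nonneg _)
      (Finset.mem_univ m)

theorem memLp_two_of_integrable_sq {α : Type*} [MeasurableSpace α] [Countable α]
    [MeasurableSingletonClass α] {μ : Measure α} {f : α → ℝ} (h : Integrable (fun x => f x ^ 2) μ) :
    MemLp f 2 μ :=
  (memLp_two_iff_integrable_sq (measurable_of_countable f).aestronglyMeasurable).2 h

theorem var_totalArrival :
    var (totalArrival A) = variance (fun a : Fin M → ℕ => ∑ m, (a m : ℝ)) A.toMeasure := by
  rw [var, totalArrival, ← PMF.toMeasure_map _ _ (measurable_of_countable _),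
    variance_map (measurable_of_countable _).aemeasurable (measurable_of_countable _).aemeasurable]
  congr 1
  funext a
  simp

variable (A S) in
/-- Joint law of the arrivals and the offered services. -/
def primitives : Measure ((Fin M → ℕ) × (Fin N → ℕ)) :=
  A.toMeasure.prod (Measure.pi fun n => (S n).toMeasure)

instance : IsProbabilityMeasure (primitives A S) := by
  unfold primitives
  infer_instance

theorem memLp_netArrivals {z : State M N}
    (hB : ∫⁻ x, ENNReal.ofReal (x.load ^ 4) ∂(outcome A S P z).toMeasure ≤ ENNReal.ofReal B) :
    MemLp netArrivals 2 (primitives A S) := by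
  refine memLp_two_of_integrable_sq ?_
  rw [primitives, ← toMeasure_map_outcome_arrivals_services A S P z, integrable_toMeasure_map_iff]
  refine integrable_of_abs_le (integrable_load_pow hB (k := 2) (by norm_num))
    (Eventually.of_forall fun x => ?_)
  rw [abs_of_nonneg (sq_nonneg _)]
  have h1 := x.sum_arrivals_nonneg
  have h2 := x.sum_services_nonneg
  have h3 := x.sum_arrivals_le_load
  have h4 := x.sum_services_le_load
  refine sq_le_sq' ?_ ?_ <;> simp only [netArrivals] <;> linarith

theorem integral_netArrivals {z : State M N}
    (hB : ∫⁻ x, ENNReal.ofReal (x.load ^ 4) ∂(outcome A S P z).toMeasure ≤ ENNReal.ofReal B) :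
    ∫ y, netArrivals y ∂primitives A S = mean (totalArrival A) - ∑ n, mean (S n) := by
  rw [primitives, ← toMeasure_map_outcome_arrivals_services A S P z, integral_toMeasure_map]
  simp only [netArrivals]
  have hi : Integrable (fun x : Outcome M N => ∑ m, (x.1 m : ℝ)) (outcome A S P z).toMeasure := by
    have h := integrable_sum_arrivals_pow hB (k := 1) (by norm_num)
    rw [← map_outcome_arrivals A S P z, integrable_toMeasure_map_iff] at h
    simpa using h
  rw [integral_sub hi (integrable_finsetSum _ fun n _ => integrable_service hB n),
    integral_finsetSum _ fun n _ => integrable_service hB n, mean_totalArrival]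
  simp_rw [integral_service]
  congr 1
  conv_rhs => rw [← map_outcome_arrivals A S P z, integral_toMeasure_map]

theorem variance_netArrivals {z : State M N}
    (hB : ∫⁻ x, ENNReal.ofReal (x.load ^ 4) ∂(outcome A S P z).toMeasure ≤ ENNReal.ofReal B) :
    variance netArrivals (primitives A S) = var (totalArrival A) + ∑ n, var (S n) := by
  have hA : MemLp (fun a : Fin M → ℕ => ∑ m, (a m : ℝ)) 2 A.toMeasure :=
    memLp_two_of_integrable_sq (integrable_sum_arrivals_pow hB (by norm_num))
  have hS : ∀ n, MemLp (fun s : ℕ => (s : ℝ)) 2 (S n).toMeasure := fun n =>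
    memLp_two_of_integrable_sq (integrable_service_pow hB (by norm_num) n)
  have hS' : MemLp (fun s : Fin N → ℕ => -∑ n, (s n : ℝ)) 2
      (Measure.pi fun n => (S n).toMeasure) :=
    (memLp_finsetSum _ fun n _ => (hS n).comp_measurePreserving (measurePreserving_eval _ n)).neg
  have h := variance_add_prod hA hS'
  have hnet : (netArrivals : (Fin M → ℕ) × (Fin N → ℕ) → ℝ)
      = fun y => ∑ m, (y.1 m : ℝ) + -∑ n, (y.2 n : ℝ) := by
    funext y
    rw [netArrivals, sub_eq_add_neg]
  rw [hnet, primitives, h, var_totalArrival, variance_fun_neg]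
  congr 1
  have h2 := variance_sum_pi (X := fun (_ : Fin N) (s : ℕ) => (s : ℝ)) hS
  simp only [var]
  rw [← h2]
  congr 1
  funext s
  simp

theorem integral_netArrivals_sq {z : State M N} {ε : ℝ}
    (hB : ∫⁻ x, ENNReal.ofReal (x.load ^ 4) ∂(outcome A S P z).toMeasure ≤ ENNReal.ofReal B)
    (hε : mean (totalArrival A) = (∑ n, mean (S n)) - ε) :
    ∫ y, netArrivals y ^ 2 ∂primitives A S
      = var (totalArrival A) + ∑ n, var (S n) + ε ^ 2 := by
  have h1 := variance_eq_sub (memLp_netArrivals hB)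
  rw [variance_netArrivals hB, integral_netArrivals hB, hε] at h1
  simp only [Pi.pow_apply] at h1
  linarith

end Net

/-! ### The system in steady state -/

section Steady

variable {M N : ℕ} (A : PMF (Fin M → ℕ)) (S : Fin N → PMF ℕ) (P : Policy M N)
  (π : PMF (State M N))

/-- Joint law of the state at the beginning of a slot and the outcome of the slot. -/
def joint : PMF (State M N × Outcome M N) := π.bind fun z => (outcome A S P z).map (Prod.mk z)

theorem map_joint_fst : (joint A S P π).map Prod.fst = π := by
  simp only [joint, PMF.map_bind, PMF.map_comp]
  have : ∀ z, PMF.map (Prod.fst ∘ Prod.mk z) (outcome A S P z) = PMF.pure z := fun z =>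
    PMF.map_const _ z
  simp_rw [this, PMF.bind_pure]

theorem map_joint_next (hπ : π.bind (step A S P) = π) :
    (joint A S P π).map (fun y => y.2.next y.1) = π := by
  simp only [joint, PMF.map_bind, PMF.map_comp]
  conv_rhs => rw [← hπ]
  congr 1
  funext z
  rw [step_eq_map_outcome]
  rfl

/-- The state at the beginning of a slot is independent of its arrivals and services, which gives
`E[T X] = E[T] E[X]` in the second-moment identity. -/
theorem toMeasure_map_joint_primitives :
    ((joint A S P π).map fun y => (y.1, (y.2.1, y.2.2.2.1))).toMeasure
      = π.toMeasure.prod (primitives A S) := by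
  have h : (joint A S P π).map (fun y => (y.1, (y.2.1, y.2.2.2.1)))
      = π.bind fun z => (A.bind fun a => (indep S).map (Prod.mk a)).map (Prod.mk z) := by
    simp only [joint]
    rw [PMF.map_bind]
    congr 1
    funext z
    rw [← map_outcome_arrivals_services A S P z, PMF.map_comp, PMF.map_comp]
    rfl
  rw [h, toMeasure_bind_map_prodMk, toMeasure_bind_map_prodMk, toMeasure_indep_nat, primitives]

theorem lintegral_joint_le {f : State M N × Outcome M N → ℝ≥0∞} {c : ℝ≥0∞}
    (h : ∀ z, ∫⁻ x, f (z, x) ∂(outcome A S P z).toMeasure ≤ c) :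
    ∫⁻ y, f y ∂(joint A S P π).toMeasure ≤ c := by
  rw [lintegral_toMeasure_eq_tsum, joint, tsum_bind_mul]
  refine tsum_pmf_mul_le_of_forall_le π fun z _ => ?_
  rw [← lintegral_toMeasure_eq_tsum, lintegral_toMeasure_map]
  exact h z

/-- Total queue length. -/
def State.total (z : State M N) : ℝ := ∑ n, z.q n

theorem State.total_nonneg (z : State M N) : 0 ≤ z.total :=
  Finset.sum_nonneg fun n _ => z.q_nonneg n

theorem State.total_sq_le (z : State M N) : z.total ^ 2 ≤ N * z.spread 0 := by
  have h := sq_sum_le_card_mul_sum_sq (s := (Finset.univ : Finset (Fin N))) (f := z.q)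
  simpa [State.total, State.spread, deviation] using h

/-- Total unused service. -/
def Outcome.totalUnused (z : State M N) (x : Outcome M N) : ℝ := ∑ n, x.unused z n

theorem Outcome.totalUnused_nonneg (z : State M N) (x : Outcome M N) : 0 ≤ x.totalUnused z :=
  Finset.sum_nonneg fun n _ => x.unused_nonneg z n

theorem Outcome.totalUnused_le_load (z : State M N) (x : Outcome M N) :
    x.totalUnused z ≤ x.load :=
  (Finset.sum_le_sum fun n _ => x.unused_le z n).trans x.sum_services_le_load

theorem Outcome.total_next (z : State M N) (x : Outcome M N) :
    (x.next z).total = z.total + netArrivals (x.1, x.2.2.1) + x.totalUnused z := by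
  simp only [State.total, Outcome.totalUnused, Outcome.unused, netArrivals,
    Finset.sum_sub_distrib, Finset.sum_add_distrib, sum_arrivalTo]
  ring

/-- Service is wasted only at empty queues, so its correlation with the total queue length is
controlled by the imbalance of the queues. -/
theorem Outcome.total_next_mul_totalUnused_le [NeZero N] (z : State M N) (x : Outcome M N) :
    (x.next z).total * x.totalUnused z ≤ N * (√((x.next z).spread 1) * x.totalUnused z) := by
  have hN : (N : ℝ) ≠ 0 := Nat.cast_ne_zero.2 (NeZero.ne N)
  -- The total is `N` times the mean, hence `N` times the difference between queue `n` and its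
  -- deviation; the queue itself is annihilated by `unused_mul_next`.
  have h1 : ∀ n, (x.next z).total * x.unused z n
      = N * (-deviation 1 (x.next z).q n * x.unused z n) := fun n => by
    have h := x.unused_mul_next z n
    have h2 : deviation 1 (x.next z).q n = (x.next z).q n - (x.next z).total / N := by
      rw [deviation, one_mul, State.total]
    rw [h2]
    field_simp
    linear_combination (N : ℝ) * h
  rw [Outcome.totalUnused, Finset.mul_sum, Finset.mul_sum, Finset.mul_sum]
  refine Finset.sum_le_sum fun n _ => ?_
  rw [h1 n]
  gcongr
  · exact x.unused_nonneg z n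
  · exact (neg_le_abs _).trans (abs_deviation_le_sqrt 1 _ n)

end Steady

/-! ### Steady-state moments of the queues and of the unused service -/

section Steady

variable {M N : ℕ} {A : PMF (Fin M → ℕ)} {S : Fin N → PMF ℕ} {P : Policy M N}
  {π : PMF (State M N)} {B : ℝ}

theorem integrable_joint_fst_iff (f : State M N → ℝ) :
    Integrable (fun y : State M N × Outcome M N => f y.1) (joint A S P π).toMeasure
      ↔ Integrable f π.toMeasure := by
  rw [← integrable_toMeasure_map_iff (joint A S P π) Prod.fst, map_joint_fst]

theorem integral_joint_fst (f : State M N → ℝ) :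
    ∫ y, f y.1 ∂(joint A S P π).toMeasure = ∫ z, f z ∂π.toMeasure := by
  rw [← integral_toMeasure_map (joint A S P π) Prod.fst f, map_joint_fst]

theorem integrable_joint_next_iff (hπ : π.bind (step A S P) = π) (f : State M N → ℝ) :
    Integrable (fun y : State M N × Outcome M N => f (y.2.next y.1)) (joint A S P π).toMeasure
      ↔ Integrable f π.toMeasure := by
  rw [← integrable_toMeasure_map_iff (joint A S P π) (fun y => y.2.next y.1),
    map_joint_next _ _ _ _ hπ]

theorem integral_joint_next (hπ : π.bind (step A S P) = π) (f : State M N → ℝ) :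
    ∫ y, f (y.2.next y.1) ∂(joint A S P π).toMeasure = ∫ z, f z ∂π.toMeasure := by
  rw [← integral_toMeasure_map (joint A S P π) (fun y => y.2.next y.1) f,
    map_joint_next _ _ _ _ hπ]

theorem integral_joint_mul_netArrivals (f : State M N → ℝ)
    (g : (Fin M → ℕ) × (Fin N → ℕ) → ℝ) :
    ∫ y, f y.1 * g (y.2.1, y.2.2.2.1) ∂(joint A S P π).toMeasure
      = (∫ z, f z ∂π.toMeasure) * ∫ w, g w ∂primitives A S := by
  rw [← integral_toMeasure_map (joint A S P π) (fun y => (y.1, (y.2.1, y.2.2.2.1)))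
    (fun y => f y.1 * g y.2), toMeasure_map_joint_primitives, integral_prod_mul]

theorem integral_joint_netArrivals (g : (Fin M → ℕ) × (Fin N → ℕ) → ℝ) :
    ∫ y, g (y.2.1, y.2.2.2.1) ∂(joint A S P π).toMeasure = ∫ w, g w ∂primitives A S := by
  have := integral_joint_mul_netArrivals (A := A) (S := S) (P := P) (π := π) (fun _ => 1) g
  simpa using this

theorem lintegral_joint_load_le
    (hB : ∀ z, ∫⁻ x, ENNReal.ofReal (x.load ^ 4) ∂(outcome A S P z).toMeasure
      ≤ ENNReal.ofReal B) :
    ∫⁻ y, ENNReal.ofReal (y.2.load ^ 4) ∂(joint A S P π).toMeasure ≤ ENNReal.ofReal B :=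
  lintegral_joint_le A S P π hB

theorem integrable_joint_load_pow
    (hB : ∀ z, ∫⁻ x, ENNReal.ofReal (x.load ^ 4) ∂(outcome A S P z).toMeasure
      ≤ ENNReal.ofReal B) {k : ℕ} (hk : k ≤ 4) :
    Integrable (fun y : State M N × Outcome M N => y.2.load ^ k) (joint A S P π).toMeasure := by
  refine integrable_of_abs_le (integrable_of_lintegral_le (fun y => by positivity)
    (lintegral_joint_load_le hB)) (Eventually.of_forall fun y => ?_)
  have h := y.2.one_le_load
  rw [abs_of_nonneg (by positivity)]
  exact pow_le_pow_right₀ h hk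

theorem integral_joint_load_cube_le (hB0 : 0 ≤ B)
    (hB : ∀ z, ∫⁻ x, ENNReal.ofReal (x.load ^ 4) ∂(outcome A S P z).toMeasure
      ≤ ENNReal.ofReal B) :
    ∫ y, y.2.load ^ 3 ∂(joint A S P π).toMeasure ≤ B :=
  (integral_mono (integrable_joint_load_pow hB (by norm_num)) (integrable_joint_load_pow hB le_rfl)
    fun y => pow_le_pow_right₀ y.2.one_le_load (by norm_num)).trans
    (integral_le_of_lintegral_le (fun y => by positivity) hB0 (lintegral_joint_load_le hB))

theorem Outcome.abs_netArrivals_le_load (x : Outcome M N) :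
    |netArrivals (x.1, x.2.2.1)| ≤ x.load := by
  have h1 := x.sum_arrivals_nonneg
  have h2 := x.sum_services_nonneg
  have h3 := x.sum_arrivals_le_load
  have h4 := x.sum_services_le_load
  simp only [netArrivals]
  rw [abs_le]
  constructor <;> linarith

theorem sq_le_one_add_cube {x : ℝ} (hx : 0 ≤ x) : x ^ 2 ≤ 1 + x ^ 3 := by
  rcases le_total x 1 with h | h
  · nlinarith [pow_nonneg hx 3]
  · nlinarith [sq_nonneg x]

theorem State.spread_le (κ : ℝ) (z : State M N) : z.spread κ ≤ 1 + √(z.spread κ) ^ 3 := by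
  have h := sq_le_one_add_cube (Real.sqrt_nonneg (z.spread κ))
  rwa [Real.sq_sqrt (z.spread_nonneg κ)] at h

theorem integrable_spread {κ C : ℝ}
    (h : ∫⁻ z, ENNReal.ofReal (√(z.spread κ) ^ 3) ∂π.toMeasure ≤ ENNReal.ofReal C) :
    Integrable (fun z => z.spread κ) π.toMeasure := by
  refine integrable_of_abs_le ((integrable_const 1).add
    (integrable_of_lintegral_le (fun z => by positivity) h)) (Eventually.of_forall fun z => ?_)
  rw [abs_of_nonneg (z.spread_nonneg κ)]
  exact z.spread_le κ

theorem integral_spread_le {κ C : ℝ} (hC : 0 ≤ C)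
    (h : ∫⁻ z, ENNReal.ofReal (√(z.spread κ) ^ 3) ∂π.toMeasure ≤ ENNReal.ofReal C) :
    ∫ z, z.spread κ ∂π.toMeasure ≤ 1 + C := by
  have hi : Integrable (fun z : State M N => √(z.spread κ) ^ 3) π.toMeasure :=
    integrable_of_lintegral_le (fun z => by positivity) h
  have hi' : Integrable (fun z : State M N => 1 + √(z.spread κ) ^ 3) π.toMeasure :=
    (integrable_const 1).add hi
  calc ∫ z, z.spread κ ∂π.toMeasure ≤ ∫ z, (1 + √(z.spread κ) ^ 3) ∂π.toMeasure :=
        integral_mono (integrable_spread h) hi' fun z => z.spread_le κ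
    _ = 1 + ∫ z, √(z.spread κ) ^ 3 ∂π.toMeasure := by
        rw [integral_add (integrable_const 1) hi]; simp
    _ ≤ _ := by
        gcongr
        exact integral_le_of_lintegral_le (fun z => by positivity) hC h

theorem integrable_total_sq {C : ℝ}
    (h : ∫⁻ z, ENNReal.ofReal (√(z.spread 0) ^ 3) ∂π.toMeasure ≤ ENNReal.ofReal C) :
    Integrable (fun z => z.total ^ 2) π.toMeasure := by
  refine integrable_of_abs_le ((integrable_spread h).const_mul (N : ℝ))
    (Eventually.of_forall fun z => ?_)
  rw [abs_of_nonneg (sq_nonneg _)]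
  exact z.total_sq_le

theorem integrable_total {C : ℝ}
    (h : ∫⁻ z, ENNReal.ofReal (√(z.spread 0) ^ 3) ∂π.toMeasure ≤ ENNReal.ofReal C) :
    Integrable (fun z => z.total) π.toMeasure := by
  refine integrable_of_abs_le ((integrable_const 1).add (integrable_total_sq h))
    (Eventually.of_forall fun z => ?_)
  rw [abs_of_nonneg z.total_nonneg]
  simp only [Pi.add_apply]
  nlinarith [sq_nonneg (z.total - 1), z.total_nonneg]

variable (A S P π) in
/-- Mean square of the unused service in steady state. -/
def unusedSq : ℝ := ∫ y, y.2.totalUnused y.1 ^ 2 ∂(joint A S P π).toMeasure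

variable (A S P π) in
/-- Mean product of the unused service and the next total queue length in steady state. -/
def unusedTotal : ℝ :=
  ∫ y, (y.2.next y.1).total * y.2.totalUnused y.1 ∂(joint A S P π).toMeasure

theorem integrable_totalUnused_pow
    (hB : ∀ z, ∫⁻ x, ENNReal.ofReal (x.load ^ 4) ∂(outcome A S P z).toMeasure
      ≤ ENNReal.ofReal B) {k : ℕ} (hk : k ≤ 4) :
    Integrable (fun y : State M N × Outcome M N => y.2.totalUnused y.1 ^ k)
      (joint A S P π).toMeasure := by
  refine integrable_of_abs_le (integrable_joint_load_pow hB hk) (Eventually.of_forall fun y => ?_)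
  have h := y.2.totalUnused_nonneg y.1
  rw [abs_of_nonneg (by positivity)]
  exact pow_le_pow_left₀ h (y.2.totalUnused_le_load y.1) k

theorem integrable_netArrivals_pow
    (hB : ∀ z, ∫⁻ x, ENNReal.ofReal (x.load ^ 4) ∂(outcome A S P z).toMeasure
      ≤ ENNReal.ofReal B) {k : ℕ} (hk : k ≤ 4) :
    Integrable (fun y : State M N × Outcome M N => netArrivals (y.2.1, y.2.2.2.1) ^ k)
      (joint A S P π).toMeasure := by
  refine integrable_of_abs_le (integrable_joint_load_pow hB hk) (Eventually.of_forall fun y => ?_)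
  rw [abs_pow]
  exact pow_le_pow_left₀ (abs_nonneg _) y.2.abs_netArrivals_le_load k

/-- In steady state, the mean unused service is the spare capacity. -/
theorem integral_totalUnused {C ε : ℝ} (hπ : π.bind (step A S P) = π)
    (hB : ∀ z, ∫⁻ x, ENNReal.ofReal (x.load ^ 4) ∂(outcome A S P z).toMeasure
      ≤ ENNReal.ofReal B)
    (hε : mean (totalArrival A) = (∑ n, mean (S n)) - ε)
    (h : ∫⁻ z, ENNReal.ofReal (√(z.spread 0) ^ 3) ∂π.toMeasure ≤ ENNReal.ofReal C) :
    ∫ y, y.2.totalUnused y.1 ∂(joint A S P π).toMeasure = ε := by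
  have hU : Integrable (fun y : State M N × Outcome M N => y.2.totalUnused y.1)
      (joint A S P π).toMeasure := by
    simpa using integrable_totalUnused_pow (π := π) hB (k := 1) (by norm_num)
  have hX : Integrable (fun y : State M N × Outcome M N => netArrivals (y.2.1, y.2.2.2.1))
      (joint A S P π).toMeasure := by
    simpa using integrable_netArrivals_pow (π := π) hB (k := 1) (by norm_num)
  have hq : Integrable (fun y : State M N × Outcome M N => y.1.total)
      (joint A S P π).toMeasure := (integrable_joint_fst_iff State.total).2 (integrable_total h)
  have hqX : Integrable (fun y : State M N × Outcome M N =>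
      y.1.total + netArrivals (y.2.1, y.2.2.2.1)) (joint A S P π).toMeasure := hq.add hX
  -- Stationarity equates the means of the total before and after the slot, so the mean unused
  -- service balances the mean net arrivals `-ε`.
  have h1 := integral_joint_next hπ (fun z => z.total)
  simp_rw [Outcome.total_next] at h1
  rw [integral_add hqX hU, integral_add hq hX, integral_joint_fst State.total,
    integral_joint_netArrivals, integral_netArrivals (hB (State.init M N)), hε] at h1
  linarith

/-- The steady-state identity for the squared total queue length. -/
theorem mul_integral_total_eq {C ε : ℝ} (hπ : π.bind (step A S P) = π)
    (hB : ∀ z, ∫⁻ x, ENNReal.ofReal (x.load ^ 4) ∂(outcome A S P z).toMeasure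
      ≤ ENNReal.ofReal B)
    (hε : mean (totalArrival A) = (∑ n, mean (S n)) - ε)
    (h : ∫⁻ z, ENNReal.ofReal (√(z.spread 0) ^ 3) ∂π.toMeasure ≤ ENNReal.ofReal C) :
    ε * ∫ z, z.total ∂π.toMeasure
      = (var (totalArrival A) + ∑ n, var (S n) + ε ^ 2) / 2 + unusedTotal A S P π
        - unusedSq A S P π / 2 := by
  have hU2 := integrable_totalUnused_pow (π := π) hB (k := 2) (by norm_num)
  have hX2 := integrable_netArrivals_pow (π := π) hB (k := 2) (by norm_num)
  have hq2 : Integrable (fun y : State M N × Outcome M N => y.1.total ^ 2)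
      (joint A S P π).toMeasure :=
    (integrable_joint_fst_iff fun z => z.total ^ 2).2 (integrable_total_sq h)
  have hq2' : Integrable (fun y : State M N × Outcome M N => (y.2.next y.1).total ^ 2)
      (joint A S P π).toMeasure :=
    (integrable_joint_next_iff hπ fun z => z.total ^ 2).2 (integrable_total_sq h)
  have hqX : Integrable (fun y : State M N × Outcome M N =>
      y.1.total * netArrivals (y.2.1, y.2.2.2.1)) (joint A S P π).toMeasure := by
    refine integrable_of_abs_le (hq2.add hX2) (Eventually.of_forall fun y => ?_)
    simp only [Pi.add_apply]
    rw [abs_le]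
    constructor <;> nlinarith [sq_nonneg (y.1.total - netArrivals (y.2.1, y.2.2.2.1)),
      sq_nonneg (y.1.total + netArrivals (y.2.1, y.2.2.2.1))]
  have hqU : Integrable (fun y : State M N × Outcome M N =>
      (y.2.next y.1).total * y.2.totalUnused y.1) (joint A S P π).toMeasure := by
    refine integrable_of_abs_le (hq2'.add hU2) (Eventually.of_forall fun y => ?_)
    simp only [Pi.add_apply]
    rw [abs_le]
    constructor <;> nlinarith [sq_nonneg ((y.2.next y.1).total - y.2.totalUnused y.1),
      sq_nonneg ((y.2.next y.1).total + y.2.totalUnused y.1)]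
  -- Pairing `U` with the next total rather than the present one is what makes the orthogonality of
  -- unused service and queue length available.
  have hpt : ∀ y : State M N × Outcome M N, (y.2.next y.1).total ^ 2
      = y.1.total ^ 2 + 2 * (y.1.total * netArrivals (y.2.1, y.2.2.2.1))
        + netArrivals (y.2.1, y.2.2.2.1) ^ 2
        + (2 * ((y.2.next y.1).total * y.2.totalUnused y.1) - y.2.totalUnused y.1 ^ 2) := by
    intro y
    rw [Outcome.total_next]
    ring
  have hs1 : Integrable (fun y : State M N × Outcome M N =>
      y.1.total ^ 2 + 2 * (y.1.total * netArrivals (y.2.1, y.2.2.2.1)))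
      (joint A S P π).toMeasure := hq2.add (hqX.const_mul 2)
  have hs2 : Integrable (fun y : State M N × Outcome M N =>
      y.1.total ^ 2 + 2 * (y.1.total * netArrivals (y.2.1, y.2.2.2.1))
        + netArrivals (y.2.1, y.2.2.2.1) ^ 2) (joint A S P π).toMeasure := hs1.add hX2
  have hs3 : Integrable (fun y : State M N × Outcome M N =>
      2 * ((y.2.next y.1).total * y.2.totalUnused y.1) - y.2.totalUnused y.1 ^ 2)
      (joint A S P π).toMeasure := (hqU.const_mul 2).sub hU2
  have h1 := integral_joint_next hπ (fun z => z.total ^ 2)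
  have h2 : ∫ y, (y.2.next y.1).total ^ 2 ∂(joint A S P π).toMeasure
      = ∫ z, z.total ^ 2 ∂π.toMeasure + 2 * ((∫ z, z.total ∂π.toMeasure) * -ε)
        + (var (totalArrival A) + ∑ n, var (S n) + ε ^ 2)
        + (2 * unusedTotal A S P π - unusedSq A S P π) := by
    rw [integral_congr_ae (Eventually.of_forall hpt), integral_add hs2 hs3, integral_add hs1 hX2,
      integral_add hq2 (hqX.const_mul 2), integral_sub (hqU.const_mul 2) hU2, integral_const_mul,
      integral_const_mul, integral_joint_fst (fun z => z.total ^ 2),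
      integral_joint_mul_netArrivals (fun z => z.total) netArrivals,
      integral_joint_netArrivals (fun w => netArrivals w ^ 2),
      integral_netArrivals (hB (State.init M N)),
      integral_netArrivals_sq (hB (State.init M N)) hε, hε, unusedTotal, unusedSq]
    ring
  linarith

/-- Truncate at load `t⁻¹`: below it `U² ≤ t⁻¹ U`, whose mean is `t⁻¹ ε`; above it `U²` is at most
`t` times the cubed load. The parameter `t` is free, to be balanced against `ε`. -/
theorem unusedSq_le {C ε t : ℝ} (hπ : π.bind (step A S P) = π) (hB0 : 0 ≤ B)
    (hB : ∀ z, ∫⁻ x, ENNReal.ofReal (x.load ^ 4) ∂(outcome A S P z).toMeasure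
      ≤ ENNReal.ofReal B)
    (hε : mean (totalArrival A) = (∑ n, mean (S n)) - ε)
    (h : ∫⁻ z, ENNReal.ofReal (√(z.spread 0) ^ 3) ∂π.toMeasure ≤ ENNReal.ofReal C)
    (ht : 0 < t) : unusedSq A S P π ≤ t⁻¹ * ε + t * B := by
  have hU : Integrable (fun y : State M N × Outcome M N => y.2.totalUnused y.1)
      (joint A S P π).toMeasure := by
    simpa using integrable_totalUnused_pow (π := π) hB (k := 1) (by norm_num)
  have hL := integrable_joint_load_pow (π := π) hB (k := 3) (by norm_num)
  have hpt : ∀ y : State M N × Outcome M N, y.2.totalUnused y.1 ^ 2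
      ≤ t⁻¹ * y.2.totalUnused y.1 + t * y.2.load ^ 3 := fun y => by
    have h0 := y.2.totalUnused_nonneg y.1
    have h1 := y.2.totalUnused_le_load y.1
    have hL0 : 0 ≤ y.2.load := h0.trans h1
    rcases le_total (y.2.load) t⁻¹ with hl | hl
    · have : 0 ≤ t * y.2.load ^ 3 := by positivity
      nlinarith [mul_le_mul_of_nonneg_right (h1.trans hl) h0]
    · have h2 : 1 ≤ t * y.2.load := by
        rw [← mul_inv_cancel₀ ht.ne']
        gcongr
      have h3 : 0 ≤ t⁻¹ * y.2.totalUnused y.1 := by positivity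
      have h4 : y.2.totalUnused y.1 ^ 2 ≤ y.2.load ^ 2 := pow_le_pow_left₀ h0 h1 2
      nlinarith [mul_le_mul_of_nonneg_left h2 (sq_nonneg y.2.load)]
  have hi : Integrable (fun y : State M N × Outcome M N =>
      t⁻¹ * y.2.totalUnused y.1 + t * y.2.load ^ 3) (joint A S P π).toMeasure :=
    (hU.const_mul _).add (hL.const_mul _)
  calc unusedSq A S P π ≤ ∫ y, (t⁻¹ * y.2.totalUnused y.1 + t * y.2.load ^ 3)
        ∂(joint A S P π).toMeasure :=
        integral_mono (integrable_totalUnused_pow hB (by norm_num)) hi hpt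
    _ = t⁻¹ * ε + t * ∫ y, y.2.load ^ 3 ∂(joint A S P π).toMeasure := by
        rw [integral_add (hU.const_mul _) (hL.const_mul _), integral_const_mul,
          integral_const_mul, integral_totalUnused hπ hB hε h]
    _ ≤ _ := by
        gcongr
        exact integral_joint_load_cube_le hB0 hB

theorem unusedTotal_nonneg : 0 ≤ unusedTotal A S P π :=
  integral_nonneg fun _ => mul_nonneg (State.total_nonneg _) (Outcome.totalUnused_nonneg _ _)

/-- A weighted arithmetic-geometric inequality separates imbalance and unused service. By
stationarity the imbalance after the slot has the same mean as before it, which is bounded by the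
third moment. -/
theorem unusedTotal_le [NeZero N] {b s : ℝ} (hπ : π.bind (step A S P) = π)
    (hb : 0 ≤ b)
    (hB : ∀ z, ∫⁻ x, ENNReal.ofReal (x.load ^ 4) ∂(outcome A S P z).toMeasure
      ≤ ENNReal.ofReal B)
    (h : ∫⁻ z, ENNReal.ofReal (√(z.spread 1) ^ 3) ∂π.toMeasure ≤ ENNReal.ofReal b)
    (hs : 0 < s) :
    unusedTotal A S P π ≤ N * (s * (1 + b) + s⁻¹ * unusedSq A S P π) := by
  have hU2 := integrable_totalUnused_pow (π := π) hB (k := 2) (by norm_num)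
  have hR : Integrable (fun y : State M N × Outcome M N => (y.2.next y.1).spread 1)
      (joint A S P π).toMeasure :=
    (integrable_joint_next_iff hπ fun z => z.spread 1).2 (integrable_spread h)
  have hi : Integrable (fun y : State M N × Outcome M N =>
      N * (s * (y.2.next y.1).spread 1 + s⁻¹ * y.2.totalUnused y.1 ^ 2))
      (joint A S P π).toMeasure := ((hR.const_mul s).add (hU2.const_mul s⁻¹)).const_mul _
  have hpt : ∀ y : State M N × Outcome M N, (y.2.next y.1).total * y.2.totalUnused y.1
      ≤ N * (s * (y.2.next y.1).spread 1 + s⁻¹ * y.2.totalUnused y.1 ^ 2) := fun y => by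
    refine (y.2.total_next_mul_totalUnused_le y.1).trans ?_
    gcongr
    have h0 := y.2.totalUnused_nonneg y.1
    have h1 := Real.sqrt_nonneg ((y.2.next y.1).spread 1)
    have h2 := Real.sq_sqrt ((y.2.next y.1).spread_nonneg 1)
    have h3 : s * s⁻¹ = 1 := mul_inv_cancel₀ hs.ne'
    have h4 : 0 < s⁻¹ := inv_pos.2 hs
    have h5 : 0 ≤ s⁻¹ * (s * √((y.2.next y.1).spread 1) - y.2.totalUnused y.1) ^ 2 := by positivity
    have h6 : s⁻¹ * (s * √((y.2.next y.1).spread 1) - y.2.totalUnused y.1) ^ 2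
        = s * (y.2.next y.1).spread 1
          - 2 * (√((y.2.next y.1).spread 1) * y.2.totalUnused y.1)
          + s⁻¹ * y.2.totalUnused y.1 ^ 2 := by
      rw [sub_sq, mul_pow, h2]
      field_simp
    nlinarith [mul_nonneg h1 h0]
  calc unusedTotal A S P π ≤ ∫ y, N * (s * (y.2.next y.1).spread 1
        + s⁻¹ * y.2.totalUnused y.1 ^ 2) ∂(joint A S P π).toMeasure := by
        refine integral_mono_of_nonneg (Eventually.of_forall fun y =>
          mul_nonneg (State.total_nonneg _) (Outcome.totalUnused_nonneg _ _)) hi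
          (Eventually.of_forall hpt)
    _ = N * (s * ∫ z, z.spread 1 ∂π.toMeasure + s⁻¹ * unusedSq A S P π) := by
        rw [integral_const_mul, integral_add (hR.const_mul s) (hU2.const_mul s⁻¹),
          integral_const_mul, integral_const_mul, integral_joint_next hπ (fun z => z.spread 1),
          unusedSq]
    _ ≤ _ := by
        gcongr
        exact integral_spread_le hb h

/-- Mean total queue length in steady state, up to error terms that vanish in heavy traffic. -/
theorem mul_integral_total_bounds [NeZero N] {b C s : ℝ} (hπ : π.bind (step A S P) = π)
    (hB0 : 0 ≤ B)
    (hB : ∀ z, ∫⁻ x, ENNReal.ofReal (x.load ^ 4) ∂(outcome A S P z).toMeasure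
      ≤ ENNReal.ofReal B) (hs : 0 < s)
    (hε : mean (totalArrival A) = (∑ n, mean (S n)) - s ^ 4)
    (h0 : ∫⁻ z, ENNReal.ofReal (√(z.spread 0) ^ 3) ∂π.toMeasure ≤ ENNReal.ofReal C)
    (hb : 0 ≤ b)
    (h1 : ∫⁻ z, ENNReal.ofReal (√(z.spread 1) ^ 3) ∂π.toMeasure ≤ ENNReal.ofReal b) :
    s ^ 4 * ∫ z, z.total ∂π.toMeasure
        ≤ (var (totalArrival A) + ∑ n, var (S n) + (s ^ 4) ^ 2) / 2 + N * (2 + b + B) * s ∧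
      (var (totalArrival A) + ∑ n, var (S n) + (s ^ 4) ^ 2) / 2 - (1 + B) * s ^ 2
        ≤ s ^ 4 * ∫ z, z.total ∂π.toMeasure := by
  have hid := mul_integral_total_eq hπ hB hε h0
  -- With `ε = s ^ 4` and truncation parameter `t = s ^ 2`, the mean of `U²` is of order `s ^ 2`;
  -- weight `s` then makes both parts of the bound on `unusedTotal` of order `s`.
  have hU := unusedSq_le hπ hB0 hB hε h0 (pow_pos hs 2)
  have hU0 : 0 ≤ unusedSq A S P π := integral_nonneg fun _ => sq_nonneg _
  have hT := unusedTotal_le hπ hb hB h1 hs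
  have hT0 : 0 ≤ unusedTotal A S P π := unusedTotal_nonneg
  have hU' : unusedSq A S P π ≤ (1 + B) * s ^ 2 := by
    have : (s ^ 2)⁻¹ * s ^ 4 = s ^ 2 := by field_simp
    linarith
  have hT' : unusedTotal A S P π ≤ N * (2 + b + B) * s := by
    refine hT.trans ?_
    have h2 : s⁻¹ * unusedSq A S P π ≤ s⁻¹ * ((1 + B) * s ^ 2) := by gcongr
    have h3 : s⁻¹ * ((1 + B) * s ^ 2) = (1 + B) * s := by field_simp
    calc _ ≤ N * (s * (1 + b) + (1 + B) * s) := 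
          mul_le_mul_of_nonneg_left (by linarith) (Nat.cast_nonneg N)
      _ = _ := by ring
  constructor <;> linarith

theorem meanTotalQueue_eq (h : Integrable (fun z => z.total) π.toMeasure) :
    meanTotalQueue π = ENNReal.ofReal (∫ z, z.total ∂π.toMeasure) := by
  rw [meanTotalQueue, ofReal_integral_eq_lintegral_ofReal h
    (Eventually.of_forall fun z => z.total_nonneg), lintegral_toMeasure_eq_tsum]
  refine tsum_congr fun z => ?_
  congr 1
  rw [← ENNReal.ofReal_natCast]
  simp [State.total, State.q]

end Steady

/-! ### Heavy traffic -/

section Main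

variable {M N : ℕ}

theorem init_mem_stateSpace (A : PMF (Fin M → ℕ)) (S : Fin N → PMF ℕ) (P : Policy M N) :
    State.init M N ∈ stateSpace A S P := Relation.ReflTransGen.refl

theorem support_step_subset (A : PMF (Fin M → ℕ)) (S : Fin N → PMF ℕ) (P : Policy M N) :
    ∀ z ∈ stateSpace A S P, (step A S P z).support ⊆ stateSpace A S P :=
  fun _ hz _ hy => Relation.ReflTransGen.tail hz hy

theorem le_one_add_cube {x : ℝ} (hx : 0 ≤ x) : x ≤ 1 + x ^ 3 := by
  rcases le_total x 1 with h | h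
  · nlinarith [pow_nonneg hx 3]
  · nlinarith [mul_nonneg hx (mul_nonneg hx hx), mul_le_mul_of_nonneg_left h hx]

/-- Only `κ = 0` is possible: the norm of the queue vector bounds every queue, and the errors then
bound the estimates, whereas the deviation from the mean leaves the total unbounded. -/
theorem finite_decrease_le {c : ℝ} (hc : 0 < c) (s : Set (State M N)) (k : ℕ) :
    {z ∈ s | ENNReal.ofReal (z.decrease 0 c) ≤ k}.Finite := by
  set L : ℕ := ⌈(1 + k / c) + (1 + k : ℝ)⌉₊ with hL
  have hinj : Function.Injective fun z : State M N => (z.queue, z.est) := fun x y h => by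
    simp only [Prod.mk.injEq] at h
    exact State.ext h.1 h.2
  refine (((Set.finite_Icc (0 : Fin N → ℕ) fun _ => L).prod
    (Set.finite_Icc (0 : Fin M → Fin N → ℕ) fun _ _ => L)).preimage hinj.injOn).subset
    fun z hz => ?_
  have h0 : z.decrease 0 c ≤ k := by
    have := hz.2
    rw [← ENNReal.ofReal_natCast, ENNReal.ofReal_le_ofReal_iff (Nat.cast_nonneg k)] at this
    exact this
  have hR0 : 0 ≤ c * √(z.spread 0) ^ 3 := by positivity
  have hR : √(z.spread 0) ^ 3 ≤ k / c := by
    rw [le_div_iff₀ hc, mul_comm]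
    rw [State.decrease] at h0
    linarith [z.sum_err_cube_nonneg]
  have hq : ∀ n, (z.queue n : ℝ) ≤ 1 + k / c := fun n => by
    have h1 := abs_deviation_le_sqrt 0 z.q n
    simp only [deviation, zero_mul, sub_zero] at h1
    have h2 : (z.queue n : ℝ) ≤ √(z.spread 0) := (le_abs_self (z.q n)).trans (by
      simpa only [State.spread, deviation, zero_mul, sub_zero] using h1)
    linarith [le_one_add_cube (Real.sqrt_nonneg (z.spread 0))]
  have he : ∀ m n, z.err m n ≤ 1 + k := fun m n => by
    have h1 := Finset.single_le_sum (f := fun i : Fin M × Fin N => z.err i.1 i.2 ^ 3)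
      (fun i _ => pow_nonneg (z.err_nonneg _ _) 3) (Finset.mem_univ (m, n))
    simp only at h1
    have h2 := le_one_add_cube (z.err_nonneg m n)
    rw [State.decrease] at h0
    linarith
  refine ⟨⟨fun _ => Nat.zero_le _, fun n => Nat.cast_le (α := ℝ).1 (le_trans ?_ (Nat.le_ceil _))⟩,
    ⟨fun _ _ => Nat.zero_le _,
      fun m n => Nat.cast_le (α := ℝ).1 (le_trans ?_ (Nat.le_ceil _))⟩⟩
  · linarith [hq n, (Nat.cast_nonneg k : (0 : ℝ) ≤ k)]
  · have h1 := (neg_le_abs ((z.queue n : ℝ) - z.est m n)).trans (he m n)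
    have h2 := hq n
    simp only
    linarith

theorem lintegral_sqrt_spread_cube_le {κ c b : ℝ} (hc : 0 < c) {π : PMF (State M N)}
    (h : ∑' z, π z * ENNReal.ofReal (z.decrease κ c) ≤ ENNReal.ofReal b) :
    ∫⁻ z, ENNReal.ofReal (√(z.spread κ) ^ 3) ∂π.toMeasure ≤ ENNReal.ofReal (b / c) := by
  rw [ENNReal.ofReal_div_of_pos hc,
    ENNReal.le_div_iff_mul_le (Or.inl (by simpa using hc)) (Or.inl ENNReal.ofReal_ne_top),
    ← lintegral_mul_const _ (measurable_of_countable _)]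
  refine le_trans (lintegral_mono fun z => ?_)
    ((lintegral_toMeasure_eq_tsum π fun z => ENNReal.ofReal (z.decrease κ c)).le.trans h)
  rw [← ENNReal.ofReal_mul (by positivity)]
  refine ENNReal.ofReal_le_ofReal ?_
  rw [State.decrease, mul_comm]
  linarith [z.sum_err_cube_nonneg]

theorem mean_nonneg (q : PMF ℕ) : 0 ≤ mean q := integral_nonneg fun _ => Nat.cast_nonneg _

/-- Drift condition for the squared queue lengths, for a fixed system. -/
theorem exists_drift_zero [NeZero N] {A : PMF (Fin M → ℕ)} {S : Fin N → PMF ℕ} {P : Policy M N}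
    (hμ : ∀ n, 0 < mean (S n)) {B ε δ p : ℝ} (hB0 : 0 ≤ B)
    (hB : ∀ z, ∫⁻ x, ENNReal.ofReal (x.load ^ 4) ∂(outcome A S P z).toMeasure
      ≤ ENNReal.ofReal B)
    (hε0 : 0 < ε) (hε : mean (totalArrival A) = (∑ n, mean (S n)) - ε) (hδ : 0 < δ)
    (htilt : ∀ m, IsDeltaTilted A S P δ m) (hp : 0 < p)
    (hupd : ∀ z ∈ stateSpace A S P, ∀ m n, ENNReal.ofReal p ≤ updateProb A S P z m n) :
    ∃ c K b : ℝ, 0 < c ∧ ∀ z ∈ stateSpace A S P,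
      ∑' y, step A S P z y * ENNReal.ofReal (y.lyapunov 0 K) + ENNReal.ofReal (z.decrease 0 c)
        ≤ ENNReal.ofReal (z.lyapunov 0 K) + ENNReal.ofReal b := by
  obtain ⟨n₀, hn₀⟩ := Finite.exists_min fun n => mean (S n)
  have hpos := sum_mean_pos hμ
  -- This rate is proportional to `ε`, so the resulting constants are not uniform in heavy traffic.
  have hc : 0 < ε / (∑ n, mean (S n)) * mean (S n₀) := mul_pos (div_pos hε0 hpos) (hμ n₀)
  obtain ⟨K, b, -, -, h⟩ := exists_lyapunov_drift M N (κ := 0) (C := 3 * ∑ n, mean (S n))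
    (Or.inl rfl) hc (mul_nonneg zero_le_three hpos.le) hB0 hp
  refine ⟨ε / (∑ n, mean (S n)) * mean (S n₀), K, b, hc,
    fun z hz => h A S P z (hB z) (hupd z hz) ?_⟩
  exact sum_deviation_zero_mul_netRate_le hμ hε0 hδ hn₀ (hμ n₀).le
    ((sum_arrivalMean (hB z)).trans hε) htilt hz

variable (M) in
/-- State-space collapse: uniform bound on the imbalance of the queues in steady state. -/
theorem exists_collapse_bound [NeZero N] {S : Fin N → PMF ℕ}
    (hμ : ∀ n, 0 < mean (S n)) {B δ p : ℝ} (hB0 : 0 ≤ B) (hδ : 0 < δ) (hp : 0 < p) :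
    ∃ b ε₁ : ℝ, 0 ≤ b ∧ 0 < ε₁ ∧ ∀ (A : PMF (Fin M → ℕ)) (P : Policy M N) (ε : ℝ)
      (π : PMF (State M N)), 0 < ε → ε ≤ ε₁ →
      (∀ z, ∫⁻ x, ENNReal.ofReal (x.load ^ 4) ∂(outcome A S P z).toMeasure
        ≤ ENNReal.ofReal B) →
      mean (totalArrival A) = (∑ n, mean (S n)) - ε →
      (∀ m, IsDeltaTilted A S P δ m) →
      (∀ z ∈ stateSpace A S P, ∀ m n, ENNReal.ofReal p ≤ updateProb A S P z m n) →
      IsSteadyState A S P π →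
      ∫⁻ z, ENNReal.ofReal (√(z.spread 1) ^ 3) ∂π.toMeasure ≤ ENNReal.ofReal b := by
  have hpos := sum_mean_pos hμ
  have hN : (0 : ℝ) < N := Nat.cast_pos.2 (NeZero.pos N)
  -- This rate does not involve `ε`, and neither do the constants derived from it; the bound is
  -- therefore uniform over all small `ε`.
  have hc : 0 < δ * (∑ n, mean (S n)) / (4 * N) := by positivity
  obtain ⟨K, b, -, hb, h⟩ := exists_lyapunov_drift M N (κ := 1) (C := 3 * ∑ n, mean (S n))
    (Or.inr rfl) hc (mul_nonneg zero_le_three hpos.le) hB0 hp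
  refine ⟨b / (δ * (∑ n, mean (S n)) / (4 * N)),
    min ((∑ n, mean (S n)) / 2) (δ * (∑ n, mean (S n)) / (4 * N)), by positivity,
    lt_min (by positivity) hc, fun A P ε π hε0 hε1 hB hε htilt hupd hπ => ?_⟩
  refine lintegral_sqrt_spread_cube_le hc (tsum_stationary_le_of_drift (step A S P)
    (s := stateSpace A S P) (V := fun z => ENNReal.ofReal (z.lyapunov 1 K))
    (fun z _ => ENNReal.ofReal_ne_top) (fun z hz => h A S P z (hB z) (hupd z hz) ?_) hπ.1 hπ.2)
  exact sum_deviation_one_mul_netRate_le hμ hε0 hδ ((sum_arrivalMean (hB z)).trans hε)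
    (hε1.trans (min_le_left _ _)) (hε1.trans (min_le_right _ _)) htilt hz

end Main

end LED

end

/-! ### Heavy-traffic optimality and the lower bound -/

theorem theorem2 {M N : ℕ}
    -- service laws of the servers, with positive rates and light tails
    (S : Fin N → PMF ℕ) (hμ : ∀ n, 0 < LED.mean (S n))
    (θ₂ D₂ : ℝ) (hθ₂ : 0 < θ₂) (hS : ∀ n, LED.ExpMomentLE (S n) θ₂ D₂)
    -- joint laws of the arrivals at the dispatchers, for the systems indexed by `ε ∈ (0, ε₀)`
    (ε₀ : ℝ) (hε₀ : 0 < ε₀) (A : ℝ → PMF (Fin M → ℕ))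
    (hmean : ∀ ε ∈ Set.Ioo 0 ε₀,
      LED.mean (LED.totalArrival (A ε)) = (∑ n, LED.mean (S n)) - ε)
    (hzero : ∀ ε ∈ Set.Ioo 0 ε₀, 0 < LED.totalArrival (A ε) 0)
    (hpos : ∀ ε ∈ Set.Ioo 0 ε₀, ∀ m, ∃ a ∈ (A ε).support, 0 < a m)
    (θ₁ D₁ : ℝ) (hθ₁ : 0 < θ₁)
    (hA : ∀ ε ∈ Set.Ioo 0 ε₀, LED.ExpMomentLE (LED.totalArrival (A ε)) θ₁ D₁)
    (σsq : ℝ)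
    (hσ : Filter.Tendsto (fun ε => LED.var (LED.totalArrival (A ε))) (nhdsWithin 0 (Set.Ioi 0))
      (nhds σsq))
    -- the policies, with `δ` and `p` independent of `ε`
    (P : ℝ → LED.Policy M N)
    (δ : ℝ) (hδ : 0 < δ)
    (htilt : ∀ ε ∈ Set.Ioo 0 ε₀, ∀ m, LED.IsDeltaTilted (A ε) S (P ε) δ m)
    (p : ℝ) (hp : 0 < p)
    (hupd : ∀ ε ∈ Set.Ioo 0 ε₀, ∀ z ∈ LED.stateSpace (A ε) S (P ε), ∀ m n,
      ENNReal.ofReal p ≤ LED.updateProb (A ε) S (P ε) z m n) :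
    (∀ ε ∈ Set.Ioo 0 ε₀, ∃ π, LED.IsSteadyState (A ε) S (P ε) π) ∧
    ∀ π : ℝ → PMF (LED.State M N),
      (∀ ε ∈ Set.Ioo 0 ε₀, LED.IsSteadyState (A ε) S (P ε) (π ε)) →
      LED.HeavyTrafficDelayOptimal π (σsq + ∑ n, LED.var (S n)) ∧
      LED.ResourcePooledLowerBound π (σsq + ∑ n, LED.var (S n)) := by
  -- Without servers the mean number of arrivals would be `-ε < 0`.
  have hN : N ≠ 0 := by
    rintro rfl
    have h1 := hmean (ε₀ / 2) ⟨by linarith, by linarith⟩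
    have h2 := LED.mean_nonneg (LED.totalArrival (A (ε₀ / 2)))
    rw [Finset.univ_eq_empty, Finset.sum_empty] at h1
    linarith
  have : NeZero N := ⟨hN⟩
  set B := LED.loadBound N θ₁ D₁ θ₂ D₂
  have hB0 : 0 ≤ B := LED.loadBound_nonneg N D₁ D₂
  have hB : ∀ ε ∈ Set.Ioo 0 ε₀, ∀ z, ∫⁻ x, ENNReal.ofReal (x.load ^ 4)
      ∂(LED.outcome (A ε) S (P ε) z).toMeasure ≤ ENNReal.ofReal B := fun ε hε z =>
    LED.lintegral_load_pow_four_le (A ε) S (P ε) hθ₁ hθ₂ (hA ε hε) hS z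
  have hdrift := fun ε (hε : ε ∈ Set.Ioo 0 ε₀) => LED.exists_drift_zero hμ hB0 (hB ε hε) hε.1
    (hmean ε hε) hδ (htilt ε hε) hp (hupd ε hε)
  refine ⟨fun ε hε => ?_, fun π hπ => ?_⟩
  · obtain ⟨c, K, b, hc, h⟩ := hdrift ε hε
    exact LED.exists_stationary_of_drift (LED.step (A ε) S (P ε))
      (LED.init_mem_stateSpace (A ε) S (P ε)) (LED.support_step_subset (A ε) S (P ε))
      ENNReal.ofReal_ne_top ENNReal.ofReal_ne_top h (LED.finite_decrease_le hc _)
  · obtain ⟨b, ε₁, hb, hε₁, hcollapse⟩ := LED.exists_collapse_bound M hμ hB0 hδ hp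
    have hbounds : ∀ᶠ ε in nhdsWithin 0 (Set.Ioi 0),
        ENNReal.ofReal ε * LED.meanTotalQueue (π ε)
          ≤ ENNReal.ofReal ((LED.var (LED.totalArrival (A ε)) + ∑ n, LED.var (S n) + ε ^ 2) / 2
            + N * (2 + b + B) * √√ε) ∧
        ENNReal.ofReal ((LED.var (LED.totalArrival (A ε)) + ∑ n, LED.var (S n) + ε ^ 2) / 2
            - (1 + B) * √√ε ^ 2) ≤ ENNReal.ofReal ε * LED.meanTotalQueue (π ε) := by
      filter_upwards [Ioo_mem_nhdsGT (lt_min hε₀ hε₁)] with ε hε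
      have hε' : ε ∈ Set.Ioo 0 ε₀ := ⟨hε.1, hε.2.trans_le (min_le_left _ _)⟩
      obtain ⟨c, K, b', hc, h⟩ := hdrift ε hε'
      -- The constant here may blow up as `ε ↓ 0`; only its finiteness is used, for integrability.
      have h0 := LED.lintegral_sqrt_spread_cube_le hc
        (LED.tsum_stationary_le_of_drift (LED.step (A ε) S (P ε))
          (fun z _ => ENNReal.ofReal_ne_top) h (hπ ε hε').1 (hπ ε hε').2)
      have h1 := hcollapse (A ε) (P ε) ε (π ε) hε.1 (hε.2.le.trans (min_le_right _ _)) (hB ε hε')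
        (hmean ε hε') (htilt ε hε') (hupd ε hε') (hπ ε hε')
      -- The error terms are expressed through `s = ε^{1/4}`.
      have hs : √√ε ^ 4 = ε := by
        calc √√ε ^ 4 = (√√ε ^ 2) ^ 2 := by ring
          _ = ε := by rw [Real.sq_sqrt (Real.sqrt_nonneg ε), Real.sq_sqrt hε.1.le]
      have h2 := LED.mul_integral_total_bounds (s := √√ε) (hπ ε hε').2 hB0 (hB ε hε')
        (Real.sqrt_pos.2 (Real.sqrt_pos.2 hε.1)) (by rw [hs]; exact hmean ε hε') h0 hb h1
      rw [hs] at h2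
      rw [LED.meanTotalQueue_eq (LED.integrable_total h0), ← ENNReal.ofReal_mul hε.1.le]
      exact ⟨ENNReal.ofReal_le_ofReal h2.1, ENNReal.ofReal_le_ofReal h2.2⟩
    have hid : Filter.Tendsto (fun ε : ℝ => ε) (nhdsWithin 0 (Set.Ioi 0)) (nhds 0) :=
      Filter.tendsto_id.mono_left nhdsWithin_le_nhds
    have hroot : Filter.Tendsto (fun ε : ℝ => √√ε) (nhdsWithin 0 (Set.Ioi 0)) (nhds 0) := by
      have := hid.sqrt.sqrt
      simpa using this
    have hmain : Filter.Tendsto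
        (fun ε => (LED.var (LED.totalArrival (A ε)) + ∑ n, LED.var (S n) + ε ^ 2) / 2)
        (nhdsWithin 0 (Set.Ioi 0)) (nhds ((σsq + ∑ n, LED.var (S n)) / 2)) := by
      have := ((hσ.add_const (∑ n, LED.var (S n))).add (hid.pow 2)).div_const 2
      simpa using this
    constructor
    · have hup := ENNReal.tendsto_ofReal (hmain.add (hroot.const_mul (N * (2 + b + B))))
      rw [mul_zero, add_zero] at hup
      exact (Filter.limsup_le_limsup (hbounds.mono fun _ h => h.1)).trans hup.limsup_eq.le
    · have hlo := ENNReal.tendsto_ofReal (hmain.sub ((hroot.pow 2).const_mul (1 + B)))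
      rw [zero_pow two_ne_zero, mul_zero, sub_zero] at hlo
      exact hlo.liminf_eq.ge.trans (Filter.liminf_le_liminf (hbounds.mono fun _ h => h.2))
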